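/- Let $n\ge 0$, let $A=(a_{ij})$ be a skew-symmetric $2n\times 2n$ matrix over a commutative ring, and for $I\subseteq[2n]$ let $\bar I=[2n]\setminus I$ and let $\mathrm{pf}_I(A)$ be the pfaffian of the submatrix of $A$ with rows and columns in $I$. Here $\mathrm{pf}(A)=\sum_\pi(-1)^{\mathrm{cn}(\pi)}a_\pi$, the sum being over the perfect matchings $\pi$ of the index set, with $a_\pi=\prod_{(i<j)\in\pi}a_{ij}$ and $\mathrm{cn}(\pi)$ the number of crossings of arcs of $\pi$. **Diagrams.** Place $1,\dots,2n$ on the left and $1',\dots,(2n)'$ on the right side of a rectangle, from top to bottom. A *symmetric TL-diagram* is a non-crossing perfect matching $D$ of these $4n$ points that is invariant under $i\leftrightarrow i'$; it is *even* if it has an even number of edges with both ends on the left side. Let $\mathcal T_n$ be the set of symmetric TL-diagrams. An edge $(i,j)$, $i<j$, of $D$ is *odd* if $i$ is odd. Let $S(D)$ be the set of all diagrams in $\mathcal T_n$ obtained from $D$ by erasing some (possibly no) odd edges together with their mirror images and joining every unmatched $i$ to $i'$. For $I\subseteq[2n]$, colour $I\cup\bar I'$ black and $I'\cup\bar I$ white;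 $D$ is *$I$-compatible* if every edge of $D$ has ends of different colours. An even $I$-compatible $D\in\mathcal T_n$ is *$I$-maximal* if there is an $I$-compatible $D'\in S(D)$ such that $S(D'')\subseteq S(D)$ for every $I$-compatible $D''\in\mathcal T_n$ with $D'\in S(D'')$. Let $\mathcal D_{\max}(I)$ be the set of $I$-maximal diagrams. **Pfaffinants.** For a perfect matching $\pi$ of $[2n]$ let $\nu(\pi)$ be the matching of $[2n]\cup[2n]'$ containing $(i,j')$ and $(i',j)$ for every $(i,j)\in\pi$. Draw the edges of $\nu(\pi)$ in the rectangle as curves running from left to right, mirror-symmetrically about the vertical axis, such that two edges meet at most once, no two are tangent, and no three meet at a point; choose one such *nice embedding* for every $\pi$. A crossing between $(i,j')$ and $(i',j)$ with $(i,j)\in\pi$ is *unpaired*; every other crossing is *paired* with its mirror image. An *uncrossing* $x\in X(\pi)$ replaces each crossing $\times$ either by $)($ (a vertical uncrossing) or by $\asymp$ (a horizontal one), the two crossings of a pair in the same way. Up to closed loops, $x$ is a diagram $D(x)\in\mathcal T_n$. Put $\mathrm{wt}(x)=2^{l(x)}(-1)^{\mathrm{uv}(x)+\mathrm{ph}(x)}$,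 where $l(x)$ is the number of closed loops (a loop and its mirror image counted once), $\mathrm{uv}(x)$ the number of unpaired vertical uncrossings, and $\mathrm{ph}(x)$ the number of horizontally uncrossed pairs of paired crossings. For $D\in\mathcal T_n$ set $$f_D(\pi)=\sum_{x\in X(\pi),\ D(x)=D}\mathrm{wt}(x),\qquad \mathrm{Pfaf}'_D(A)=\sum_\pi f_D(\pi)\,a_\pi ,$$ and, for even $D$, define the *TL-pfaffinant* $\mathrm{Pfaf}_D(A)=\sum_{D'\in S(D)}\mathrm{Pfaf}'_{D'}(A)$. **Theorem.** For every choice of the nice embeddings and every $I\subseteq[2n]$ of even cardinality, $$\mathrm{pf}_I(A)\,\mathrm{pf}_{\bar I}(A)=\sum_{D\in\mathcal D_{\max}(I)}\mathrm{Pfaf}_D(A).$$ -/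

import Mathlib

open scoped Matrix

namespace TLPfaffinant

noncomputable section

open Finset
open scoped Classical

/-! ### Matchings and pfaffians -/

/-- A (perfect) matching of `α`, given as the fixed-point-free involution that sends every element
to its partner. -/
def Matching (α : Type*) : Type _ :=
  {π : Equiv.Perm α // ∀ i, π i ≠ i ∧ π (π i) = i}

/-- The partner of `i` in the matching. -/
def Matching.partner {α : Type*} (π : Matching α) (i : α) : α := π.1 i

instance {α : Type*} [Fintype α] : Fintype (Matching α) :=
  inferInstanceAs (Fintype {π : Equiv.Perm α // ∀ i, π i ≠ i ∧ π (π i) = i})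

/-- The crossing number `cn(π)`: the number of pairs of arcs `(i, k)`, `(j, l)` of `π` with
`i < j < k < l`. -/
def Matching.crossingNumber {α : Type*} [Fintype α] [LinearOrder α] (π : Matching α) : ℕ :=
  #{e : α × α | e.1 < e.2 ∧ e.2 < π.partner e.1 ∧ π.partner e.1 < π.partner e.2}

/-- The monomial `a_π`, the product of `a_{ij}` over the edges `(i, j)`, `i < j`, of `π`. -/
def Matching.monomial {α : Type*} [Fintype α] [LinearOrder α] {R : Type*} [CommRing R]
    (π : Matching α) (A : Matrix α α R) : R :=
  ∏ i : α with i < π.partner i, A i (π.partner i)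

/-- The pfaffian `pf(A) = ∑_π (-1)^{cn(π)} a_π`. -/
def pfaffian {α : Type*} [Fintype α] [LinearOrder α] {R : Type*} [CommRing R]
    (A : Matrix α α R) : R :=
  ∑ π : Matching α, (-1) ^ π.crossingNumber * π.monomial A

/-- `pf_I(A)`: the pfaffian of the submatrix of `A` with rows and columns in `I`. -/
def subPfaffian {α : Type*} [Fintype α] [LinearOrder α] {R : Type*} [CommRing R]
    (I : Finset α) (A : Matrix α α R) : R :=
  pfaffian (A.submatrix (Subtype.val : I → α) (Subtype.val : I → α))

/-! ### Symmetric Temperley-Lieb diagrams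

The point `i` on the left side of the rectangle is `Sum.inl i`, the point `i'` on the right side is
`Sum.inr i`; `Fin (2 * n)` numbers the `2n` points of a side `0, …, 2n - 1` from top to bottom. -/

/-- The `4n` boundary points. -/
abbrev Vertex (n : ℕ) : Type := Fin (2 * n) ⊕ Fin (2 * n)

/-- The position of a boundary point when one walks around the rectangle, down the left side and
up the right side. -/
def Vertex.rank {n : ℕ} : Vertex n → ℕ
  | Sum.inl i => i
  | Sum.inr i => 4 * n - 1 - i

/-- A symmetric TL-diagram: a matching of the `4n` boundary points that is non-crossing and
invariant under the reflection in the vertical axis. -/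
@[ext] structure SymDiagram (n : ℕ) where
  matching : Matching (Vertex n)
  noncrossing : ∀ u v : Vertex n, ¬ (u.rank < v.rank ∧ v.rank < (matching.partner u).rank ∧
    (matching.partner u).rank < (matching.partner v).rank)
  symmetric : ∀ v : Vertex n, matching.partner v.swap = (matching.partner v).swap

instance (n : ℕ) : Fintype (SymDiagram n) :=
  Fintype.ofInjective SymDiagram.matching fun _ _ h => SymDiagram.ext h

namespace SymDiagram

variable {n : ℕ}

/-- The partner of a boundary point in `D`. -/
def partner (D : SymDiagram n) (v : Vertex n) : Vertex n := D.matching.partner v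

/-- The order `|D|`: the number of edges with both ends on the left side. -/
def order (D : SymDiagram n) : ℕ :=
  #{e : Fin (2 * n) × Fin (2 * n) | e.1 < e.2 ∧ D.partner (Sum.inl e.1) = Sum.inl e.2}

/-- `D` is even. -/
def IsEven (D : SymDiagram n) : Prop := Even D.order

/-- The black points of the `I`-colouring: `I ∪ Ī'` is black and `I' ∪ Ī` is white. -/
def IsBlack (I : Finset (Fin (2 * n))) : Vertex n → Prop
  | Sum.inl i => i ∈ I
  | Sum.inr i => i ∉ I

/-- `I`-compatibility: the ends of every edge have different colours in the `I`-colouring. -/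
def Compatible (I : Finset (Fin (2 * n))) (D : SymDiagram n) : Prop :=
  ∀ v : Vertex n, IsBlack I v ↔ ¬ IsBlack I (D.partner v)

/-- `S(D)`: the symmetric diagrams obtained from `D` by erasing some odd edges together with their
mirror images and joining every unmatched `i` to `i'`. An edge of the left side is odd if its upper
end is an odd point in the numbering `1, …, 2n`, hence an even element of `Fin (2 * n)`. -/
def S (D : SymDiagram n) : Finset (SymDiagram n) :=
  {D' | ∀ i : Fin (2 * n), D'.partner (Sum.inl i) = D.partner (Sum.inl i) ∨
    (D'.partner (Sum.inl i) = Sum.inr i ∧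
      ∃ j : Fin (2 * n), D.partner (Sum.inl i) = Sum.inl j ∧ Even (min i j : Fin (2 * n)).val)}

/-- `D` is `I`-maximal: it is an even `I`-compatible diagram which, for some `I`-compatible `D'`
with `D' ∈ S(D)`, satisfies `S(D'') ⊆ S(D)` for all `I`-compatible `D''` with `D' ∈ S(D'')`. -/
def IsMaximal (I : Finset (Fin (2 * n))) (D : SymDiagram n) : Prop :=
  D.IsEven ∧ D.Compatible I ∧ ∃ D' : SymDiagram n, D'.Compatible I ∧ D' ∈ D.S ∧
    ∀ D'' : SymDiagram n, D''.Compatible I → D' ∈ D''.S → D''.S ⊆ D.S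

end SymDiagram

/-! ### Nice embeddings and their uncrossings -/

/-- A nice embedding of `ν(π)` in the rectangle, all edges running from left to right.
The edge `(i, π(i)')` of `ν(π)` is called strand `i`. The drawing is cut by vertical lines
`0, …, length` which avoid the crossings, are placed symmetrically, start at the left and end at
the right side of the rectangle, and are chosen so that the crossings between two consecutive lines
all lie on one vertical line. It is recorded by the places (from top to bottom) at which the
strands meet these lines. -/
structure NiceEmbedding {n : ℕ} (π : Matching (Fin (2 * n))) where
  length : ℕ
  /-- `pos t i` is the place of strand `i` on line `t`. -/
  pos : Fin (length + 1) → Equiv.Perm (Fin (2 * n))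
  /-- Strand `i` starts at the point `i`. -/
  pos_zero : ∀ i, pos 0 i = i
  /-- Strand `i` ends at the point `π(i)'`. -/
  pos_last : ∀ i, pos (Fin.last length) i = π.partner i
  /-- Between two consecutive lines some disjoint pairs of neighbouring strands cross, and nothing
  else happens (as the places on each line are permuted, this is the same as saying that no strand
  moves by more than one place); so crossings are transversal and no three strands meet. -/
  step : ∀ (t : Fin length) (i : Fin (2 * n)),
    (pos t.succ i : ℕ) ≤ pos t.castSucc i + 1 ∧ (pos t.castSucc i : ℕ) ≤ pos t.succ i + 1
  /-- Mirror symmetry: the mirror image of the edge `(i, π(i)')` is the edge `(π(i), i')`. -/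
  mirror : ∀ (t : Fin (length + 1)) (i : Fin (2 * n)), pos t.rev (π.partner i) = pos t i
  /-- Two strands cross at most once. -/
  crossOnce : ∀ (i j : Fin (2 * n)) (s t : Fin length),
    ¬ (pos s.castSucc i < pos s.castSucc j ↔ pos s.succ i < pos s.succ j) →
    ¬ (pos t.castSucc i < pos t.castSucc j ↔ pos t.succ i < pos t.succ j) → s = t

namespace NiceEmbedding

variable {n : ℕ} {π : Matching (Fin (2 * n))} (E : NiceEmbedding π)

/-- The site `(t, p)` lies between the lines `t` and `t + 1`, at the places `p` and `p + 1`. -/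
abbrev Site : Type := Fin E.length × Fin (2 * n)

/-- The strand at place `p` on the line to the left of the site `(t, p)`. -/
def upperStrand (c : E.Site) : Fin (2 * n) := (E.pos c.1.castSucc).symm c.2

/-- There is a crossing at the site `(t, p)`: the strand at place `p` on line `t` is at place
`p + 1` on line `t + 1` (hence the two strands at places `p`, `p + 1` are interchanged). -/
def IsCrossing (c : E.Site) : Prop :=
  (E.pos c.1.succ (E.upperStrand c) : ℕ) = c.2 + 1

/-- The crossing `(t, p)` is unpaired: it is between the edges `(i, j')` and `(i', j)` for an edge
`(i, j)` of `π`. -/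
def IsUnpaired (c : E.Site) : Prop :=
  E.IsCrossing c ∧ (E.pos c.1.castSucc (π.partner (E.upperStrand c)) : ℕ) = c.2 + 1

/-- The crossing is paired, the other crossing of the pair being its mirror image. -/
def IsPaired (c : E.Site) : Prop :=
  E.IsCrossing c ∧ ¬ E.IsUnpaired c

/-- The mirror image of a site. -/
def siteMirror (c : E.Site) : E.Site := (c.1.rev, c.2)

/-- The set `X(π)` of uncrossings. An uncrossing is given by the set of the crossings that are
uncrossed vertically (as `)(`); all others are uncrossed horizontally. Paired crossings are
uncrossed in the same way. -/
def uncrossings : Finset (Finset E.Site) :=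
  {x | (∀ c ∈ x, E.IsCrossing c) ∧ ∀ c ∈ x, E.siteMirror c ∈ x}

/-- The meeting points of the drawing with the vertical lines; `(t, p)` is at place `p` on
line `t`. -/
abbrev Point : Type := Fin (E.length + 1) × Fin (2 * n)

/-- One of the arcs of the uncrossed drawing `x` between two consecutive vertical lines joins
`a` and `b`. At a vertical uncrossing, the two points on the left of it are joined, and so are the
two points on the right of it; all other points are joined to the point at the same place on
the next line. -/
def Arc (x : Finset E.Site) (a b : E.Point) : Prop :=
  (∃ (t : Fin E.length) (p : Fin (2 * n)), a = (t.castSucc, p) ∧ b = (t.succ, p) ∧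
    ∀ c ∈ x, c.1 = t → (p : ℕ) ≠ c.2 ∧ (p : ℕ) ≠ c.2 + 1) ∨
  (∃ c ∈ x, (a.1 = c.1.castSucc ∨ a.1 = c.1.succ) ∧ b.1 = a.1 ∧
    a.2 = c.2 ∧ (b.2 : ℕ) = c.2 + 1)

/-- The uncrossed drawing `x`; its connected components are its strands and closed loops. -/
def graph (x : Finset E.Site) : SimpleGraph E.Point := SimpleGraph.fromRel (E.Arc x)

/-- The boundary points as points of the drawing. -/
def boundary : Vertex n → E.Point
  | Sum.inl i => (0, i)
  | Sum.inr i => (Fin.last E.length, i)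

/-- `D(x) = D`: two boundary points are joined by `D` if and only if they are the ends of a strand
of `x`. -/
def HasDiagram (x : Finset E.Site) (D : SymDiagram n) : Prop :=
  ∀ u v : Vertex n, u ≠ v →
    ((E.graph x).Reachable (E.boundary u) (E.boundary v) ↔ D.partner u = v)

/-- The mirror image of a point. -/
def pointMirror (a : E.Point) : E.Point := (a.1.rev, a.2)

/-- The number `l(x)` of closed loops, that is of components without boundary points, where a loop
and its mirror image count only once. -/
def loops (x : Finset E.Site) : ℕ :=
  Set.ncard {s : Set E.Point | ∃ C : (E.graph x).ConnectedComponent,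
    (∀ v : Vertex n, E.boundary v ∉ C.supp) ∧ s = C.supp ∪ E.pointMirror '' C.supp}

/-- The number `uv(x)` of unpaired vertical uncrossings. -/
def unpairedVertical (x : Finset E.Site) : ℕ :=
  #{c : E.Site | E.IsUnpaired c ∧ c ∈ x}

/-- The number `ph(x)` of paired horizontal uncrossings. A pair counts once: of the two crossings
of a pair only the one left of the axis is counted. -/
def pairedHorizontal (x : Finset E.Site) : ℕ :=
  #{c : E.Site | E.IsPaired c ∧ c ∉ x ∧ c.1 < c.1.rev}

/-- `wt(x) = 2^{l(x)} (-1)^{uv(x) + ph(x)}`. -/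
def weight (x : Finset E.Site) : ℤ :=
  2 ^ E.loops x * (-1) ^ (E.unpairedVertical x + E.pairedHorizontal x)

/-- `f_D(π)`, computed with the given nice embedding of `ν(π)`. -/
def coeff (D : SymDiagram n) : ℤ :=
  ∑ x ∈ E.uncrossings with E.HasDiagram x D, E.weight x

end NiceEmbedding

/-! ### Pfaffinants -/

/-- The diagram pfaffinant `Pfaf'_D(A)`; `emb` is the chosen nice embedding of each `ν(π)`. -/
def diagramPfaffinant {n : ℕ} {R : Type*} [CommRing R]
    (emb : ∀ π : Matching (Fin (2 * n)), NiceEmbedding π) (D : SymDiagram n)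
    (A : Matrix (Fin (2 * n)) (Fin (2 * n)) R) : R :=
  ∑ π : Matching (Fin (2 * n)), ((emb π).coeff D : R) * π.monomial A

/-- The TL-pfaffinant `Pfaf_D(A)`. -/
def tlPfaffinant {n : ℕ} {R : Type*} [CommRing R]
    (emb : ∀ π : Matching (Fin (2 * n)), NiceEmbedding π) (D : SymDiagram n)
    (A : Matrix (Fin (2 * n)) (Fin (2 * n)) R) : R :=
  ∑ D' ∈ D.S, diagramPfaffinant emb D' A

/-- The set `𝒟_max(I)` of `I`-maximal diagrams. -/
def maximalDiagrams {n : ℕ} (I : Finset (Fin (2 * n))) : Finset (SymDiagram n) :=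
  {D | D.IsMaximal I}

end

end TLPfaffinant

/-! Both sides are compared coefficientwise in the monomials `a_π`. On the left, a matching of `I`
and one of its complement glue to a matching `π` of all points without edges between `I` and its
complement; the sign counts the crossing pairs of arcs of equal colour
(`subPfaffian_mul_subPfaffian_compl`). On the right, the sets `S(D)` of the maximal diagrams
partition the compatible diagrams (`sum_maximalDiagrams`), so the coefficient is the sum of `f_D(π)`
over all compatible `D`.

That sum is evaluated as a state sum. Orient the strands and loops of an uncrossing so that black
boundary points are sources and reflection reverses directions. This is possible exactly when the
diagram is compatible, and then each loop, up to reflection, is free: this accounts for the factor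
`2 ^ l` (`card_colourings`). An orientation is encoded by the set `G` of points where "directed
rightwards" agrees with "even place"; a vertical uncrossing flips both, so `G` is a union of
components.

Now fix `G` and sum over the uncrossings. If the four ends at some crossing alternate between in and
out (`IsFlat`), both uncrossings are allowed there, and switching this crossing with its mirror
image reverses the sign, so everything cancels (`sum_sign_eq_zero`). Otherwise the orientation runs
straight through every crossing and hence along the edges of `ν(π)`. Reflection then forces `π` to
respect `I`, and one term is left: crossings of oppositely directed edges are uncrossed vertically,
the others horizontally. Its sign comes from counting inversions (`Matching.card_inversions`).

For the partition, through points alternate in parity, so erased odd edges can only return between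
consecutive through points with odd-numbered upper point. Among compatible completions there is thus
a greatest one, which joins every such pair of different colours (`exists_greatest`). The pairs it
leaves unjoined are monochromatic, which makes it even when `I` is (`isEven_of_greatest`). -/

namespace TLPfaffinant

noncomputable section

open Finset
open scoped Classical

/-! ### Matchings as fixed-point-free involutions -/

namespace Matching

variable {α : Type*} (π : Matching α)

theorem partner_ne (i : α) : π.partner i ≠ i := (π.2 i).1

@[simp] theorem partner_partner (i : α) : π.partner (π.partner i) = i := (π.2 i).2

theorem partner_injective : Function.Injective π.partner := π.1.injective

theorem ext_partner {π ρ : Matching α} (h : ∀ i, π.partner i = ρ.partner i) : π = ρ :=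
  Subtype.ext (Equiv.ext h)

/-- The matching given by a fixed-point-free involution. -/
def ofInvolutive (f : α → α) (hf : Function.Involutive f) (hne : ∀ i, f i ≠ i) : Matching α :=
  ⟨hf.toPerm, fun i => ⟨hne i, hf i⟩⟩

end Matching

/-- A permutation of `Fin m` that moves no element by more than one place and moves `p` down to
`p + 1` interchanges `p` and `p + 1`. -/
theorem perm_swap_of_step {m : ℕ} (σ : Equiv.Perm (Fin m))
    (hσ : ∀ k, (σ k : ℕ) ≤ k + 1 ∧ (k : ℕ) ≤ σ k + 1) :
    ∀ (N : ℕ) (p : Fin m), (p : ℕ) = N → (σ p : ℕ) = p + 1 → (σ.symm p : ℕ) = p + 1 := by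
  intro N
  induction N using Nat.strong_induction_on with
  | _ N ih =>
    intro p hp h
    have h1 := hσ (σ.symm p)
    rw [Equiv.apply_symm_apply] at h1
    rcases lt_trichotomy (σ.symm p : ℕ) p with hlt | heq | hgt
    -- If `p - 1` moved down to `p`, induction would make it and `p` swap, so `σ p` would be `p -
    -- 1`.
    · have h2 := ih (σ.symm p : ℕ) (by omega) (σ.symm p) rfl (by
        rw [Equiv.apply_symm_apply]; omega)
      have h3 : σ.symm (σ.symm p) = p := Fin.ext (by omega)
      have h4 : σ p = σ.symm p := by rw [Equiv.symm_apply_eq] at h3; exact h3.symm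
      rw [h4] at h; omega
    · have h3 : σ.symm p = p := Fin.ext heq
      rw [Equiv.symm_apply_eq] at h3
      rw [← h3] at h; omega
    · omega

/-! ### Crossings of a nice embedding and their mirror images -/

namespace NiceEmbedding

variable {n : ℕ} {π : Matching (Fin (2 * n))} (E : NiceEmbedding π)

/-- The strand at place `p` on the line to the right of the site `(t, p)`; at a crossing it is the
strand which enters at place `p + 1`. -/
def lowerStrand (c : E.Site) : Fin (2 * n) := (E.pos c.1.succ).symm c.2

@[simp] theorem pos_upperStrand (c : E.Site) : E.pos c.1.castSucc (E.upperStrand c) = c.2 := by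
  simp [upperStrand]

@[simp] theorem pos_lowerStrand (c : E.Site) : E.pos c.1.succ (E.lowerStrand c) = c.2 := by
  simp [lowerStrand]

variable {E}

theorem isCrossing_iff_lower {c : E.Site} :
    E.IsCrossing c ↔ (E.pos c.1.castSucc (E.lowerStrand c) : ℕ) = c.2 + 1 := by
  constructor
  · intro h
    have := perm_swap_of_step ((E.pos c.1.castSucc).symm.trans (E.pos c.1.succ))
      (fun k => by simpa using E.step c.1 ((E.pos c.1.castSucc).symm k)) _ c.2 rfl h
    simpa [lowerStrand] using this
  · intro h
    have := perm_swap_of_step ((E.pos c.1.succ).symm.trans (E.pos c.1.castSucc))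
      (fun k => by simpa using (E.step c.1 ((E.pos c.1.succ).symm k)).symm) _ c.2 rfl h
    simpa [IsCrossing, upperStrand] using this

theorem IsCrossing.pos_upper {c : E.Site} (h : E.IsCrossing c) :
    (E.pos c.1.succ (E.upperStrand c) : ℕ) = c.2 + 1 := h

theorem IsCrossing.pos_lower {c : E.Site} (h : E.IsCrossing c) :
    (E.pos c.1.castSucc (E.lowerStrand c) : ℕ) = c.2 + 1 := isCrossing_iff_lower.1 h

theorem IsCrossing.lt {c : E.Site} (h : E.IsCrossing c) : (c.2 : ℕ) + 1 < 2 * n := by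
  rw [← h.pos_upper]; exact Fin.is_lt _

/-- The place below the place of a crossing. -/
def IsCrossing.below {c : E.Site} (h : E.IsCrossing c) : Fin (2 * n) := ⟨c.2 + 1, h.lt⟩

theorem IsCrossing.pos_upper' {c : E.Site} (h : E.IsCrossing c) :
    E.pos c.1.succ (E.upperStrand c) = h.below := Fin.ext h.pos_upper

theorem IsCrossing.pos_lower' {c : E.Site} (h : E.IsCrossing c) :
    E.pos c.1.castSucc (E.lowerStrand c) = h.below := Fin.ext h.pos_lower

/-- Crossings between the same two lines do not overlap. -/
theorem IsCrossing.not_overlap {c d : E.Site} (hc : E.IsCrossing c) (hd : E.IsCrossing d)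
    (h : c.1 = d.1) : (c.2 : ℕ) + 1 ≠ d.2 := by
  intro hcd
  have h1 : E.pos c.1.castSucc (E.lowerStrand c) = E.pos c.1.castSucc (E.upperStrand d) := by
    rw [hc.pos_lower', h, pos_upperStrand]; exact Fin.ext hcd
  have h2 := (E.pos c.1.castSucc).injective h1
  have h3 := hd.pos_upper
  rw [← h, ← h2, pos_lowerStrand] at h3
  omega

theorem succ_rev (t : Fin E.length) : t.rev.succ = t.castSucc.rev := by
  rw [Fin.rev_castSucc]

theorem castSucc_rev (t : Fin E.length) : t.rev.castSucc = t.succ.rev := by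
  rw [Fin.rev_succ]

theorem lowerStrand_siteMirror (c : E.Site) :
    E.lowerStrand (E.siteMirror c) = π.partner (E.upperStrand c) := by
  unfold lowerStrand siteMirror
  rw [Equiv.symm_apply_eq]
  simp only
  rw [succ_rev, E.mirror, pos_upperStrand]

theorem upperStrand_siteMirror (c : E.Site) :
    E.upperStrand (E.siteMirror c) = π.partner (E.lowerStrand c) := by
  unfold upperStrand siteMirror
  rw [Equiv.symm_apply_eq]
  simp only
  rw [castSucc_rev, E.mirror, pos_lowerStrand]

@[simp] theorem siteMirror_siteMirror (c : E.Site) : E.siteMirror (E.siteMirror c) = c := by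
  simp [siteMirror]

@[simp] theorem isCrossing_siteMirror {c : E.Site} :
    E.IsCrossing (E.siteMirror c) ↔ E.IsCrossing c := by
  rw [IsCrossing, upperStrand_siteMirror, isCrossing_iff_lower]
  simp only [siteMirror]
  rw [succ_rev, E.mirror]

theorem isUnpaired_iff {c : E.Site} :
    E.IsUnpaired c ↔ E.IsCrossing c ∧ π.partner (E.upperStrand c) = E.lowerStrand c := by
  refine and_congr_right fun h => ?_
  rw [← h.pos_lower, ← Fin.ext_iff, (E.pos _).injective.eq_iff]

/-- Reflection sends a crossing of the strands `i` and `π(i)` to a crossing of the same two strands;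
as they cross only once, it lies on the axis. Conversely, reflection sends the upper strand of a
crossing to the partner of the lower one. -/
theorem isUnpaired_iff_axis {c : E.Site} :
    E.IsUnpaired c ↔ E.IsCrossing c ∧ E.siteMirror c = c := by
  rw [isUnpaired_iff]
  refine and_congr_right fun h => ⟨fun h' => ?_, fun h' => ?_⟩
  · have hm : c.1.rev = c.1 := by
      apply E.crossOnce (E.upperStrand c) (E.lowerStrand c)
      · have h1 := E.mirror c.1.succ (E.lowerStrand c)
        have h2 := E.mirror c.1.succ (E.upperStrand c)
        have h3 := E.mirror c.1.castSucc (E.lowerStrand c)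
        have h4 := E.mirror c.1.castSucc (E.upperStrand c)
        rw [← h', π.partner_partner] at h1 h3
        rw [castSucc_rev, succ_rev, h1, ← h', h2, h3, h4, h', Fin.lt_def, Fin.lt_def,
          h.pos_upper, h.pos_lower]
        simp
      · rw [Fin.lt_def, Fin.lt_def, h.pos_upper, h.pos_lower]
        simp
    exact Prod.ext hm rfl
  · rw [← lowerStrand_siteMirror, h']

theorem isUnpaired_siteMirror {c : E.Site} :
    E.IsUnpaired (E.siteMirror c) ↔ E.IsUnpaired c := by
  rw [isUnpaired_iff_axis, isUnpaired_iff_axis, isCrossing_siteMirror, siteMirror_siteMirror]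
  exact and_congr_right fun _ => eq_comm

theorem mem_uncrossings {x : Finset E.Site} : x ∈ E.uncrossings ↔
    (∀ c ∈ x, E.IsCrossing c) ∧ ∀ c ∈ x, E.siteMirror c ∈ x := by
  simp [uncrossings]

theorem siteMirror_mem_iff {x : Finset E.Site} (hx : x ∈ E.uncrossings) {c : E.Site} :
    E.siteMirror c ∈ x ↔ c ∈ x :=
  ⟨fun h => by simpa using (mem_uncrossings.1 hx).2 _ h, (mem_uncrossings.1 hx).2 c⟩

/-! ### Arcs -/

@[simp] theorem pointMirror_pointMirror (a : E.Point) : E.pointMirror (E.pointMirror a) = a := by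
  simp [pointMirror]

theorem pointMirror_boundary (v : Vertex n) :
    E.pointMirror (E.boundary v) = E.boundary v.swap := by
  cases v <;> simp [pointMirror, boundary]

theorem reachable_of_arc {x : Finset E.Site} {a b : E.Point} (h : E.Arc x a b) :
    (E.graph x).Reachable a b := by
  by_cases hab : a = b
  · rw [hab]
  · exact SimpleGraph.Adj.reachable ((SimpleGraph.fromRel_adj _ _ _).2 ⟨hab, Or.inl h⟩)

/-- Replaces reasoning about walks: to separate components it is enough to find a property that no
single arc changes. -/
theorem mem_iff_of_reachable {x : Finset E.Site} {P : E.Point → Prop}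
    (hP : ∀ a b, E.Arc x a b → (P a ↔ P b)) {a b : E.Point}
    (h : (E.graph x).Reachable a b) : P a ↔ P b := by
  obtain ⟨w⟩ := h
  induction w with
  | nil => rfl
  | cons hadj _ ih =>
    rw [← ih]
    rcases ((SimpleGraph.fromRel_adj _ _ _).1 hadj).2 with h | h
    · exact hP _ _ h
    · exact (hP _ _ h).symm

theorem arc_mirror {x : Finset E.Site} (hx : x ∈ E.uncrossings) {a b : E.Point}
    (h : E.Arc x a b) :
    E.Arc x (E.pointMirror a) (E.pointMirror b) ∨ E.Arc x (E.pointMirror b) (E.pointMirror a) := by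
  rcases h with ⟨t, p, rfl, rfl, h⟩ | ⟨c, hc, h1, h2, h3, h4⟩
  · refine Or.inr (Or.inl ⟨t.rev, p, ?_, ?_, ?_⟩)
    · simp [pointMirror, castSucc_rev]
    · simp [pointMirror, succ_rev]
    · intro c hc hct
      exact h (E.siteMirror c) ((mem_uncrossings.1 hx).2 c hc) (by simp [siteMirror, hct])
  · refine Or.inl (Or.inr ⟨E.siteMirror c, (mem_uncrossings.1 hx).2 c hc, ?_, ?_, h3, h4⟩)
    · simp only [pointMirror, siteMirror]
      rw [castSucc_rev, succ_rev, Fin.rev_inj, Fin.rev_inj]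
      exact h1.symm
    · simp [pointMirror, h2]

theorem reachable_mirror {x : Finset E.Site} (hx : x ∈ E.uncrossings) {a b : E.Point}
    (h : (E.graph x).Reachable a b) :
    (E.graph x).Reachable (E.pointMirror a) (E.pointMirror b) := by
  refine (mem_iff_of_reachable (x := x)
    (P := fun b => (E.graph x).Reachable (E.pointMirror a) (E.pointMirror b)) ?_ h).1
    (SimpleGraph.Reachable.refl _)
  intro c d hcd
  have : (E.graph x).Reachable (E.pointMirror c) (E.pointMirror d) := by
    rcases arc_mirror hx hcd with h | h
    · exact reachable_of_arc h
    · exact (reachable_of_arc h).symm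
  exact ⟨fun h => h.trans this, fun h => h.trans this.symm⟩

theorem arc_vertical_left {x : Finset E.Site} {c : E.Site} (hc : c ∈ x) (h : E.IsCrossing c) :
    E.Arc x (c.1.castSucc, c.2) (c.1.castSucc, h.below) :=
  Or.inr ⟨c, hc, Or.inl rfl, rfl, rfl, rfl⟩

theorem arc_vertical_right {x : Finset E.Site} {c : E.Site} (hc : c ∈ x) (h : E.IsCrossing c) :
    E.Arc x (c.1.succ, c.2) (c.1.succ, h.below) :=
  Or.inr ⟨c, hc, Or.inr rfl, rfl, rfl, rfl⟩

/-- A property is constant along the arcs if it is so at every vertical uncrossing and at every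
place without vertical uncrossing. -/
theorem arc_closed_iff {x : Finset E.Site} (hx : x ∈ E.uncrossings) {P : E.Point → Prop} :
    (∀ a b, E.Arc x a b → (P a ↔ P b)) ↔
      (∀ t (p : Fin (2 * n)), (∀ c ∈ x, c.1 = t → (p : ℕ) ≠ c.2 ∧ (p : ℕ) ≠ c.2 + 1) →
        (P (t.castSucc, p) ↔ P (t.succ, p))) ∧
      ∀ c ∈ x, ∀ h : E.IsCrossing c, (P (c.1.castSucc, c.2) ↔ P (c.1.castSucc, h.below)) ∧
        (P (c.1.succ, c.2) ↔ P (c.1.succ, h.below)) := by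
  constructor
  · intro h
    exact ⟨fun t p hp => h _ _ (Or.inl ⟨t, p, rfl, rfl, hp⟩),
      fun c hc hcr => ⟨h _ _ (arc_vertical_left hc hcr), h _ _ (arc_vertical_right hc hcr)⟩⟩
  · rintro ⟨h1, h2⟩ ⟨s, p⟩ ⟨s', p'⟩ (⟨t, q, ha, hb, hq⟩ | ⟨c, hc, h3, h4, h5, h6⟩)
    · rw [ha, hb]; exact h1 t q hq
    · have hcr := (mem_uncrossings.1 hx).1 c hc
      simp only at h3 h4 h5 h6
      have h7 : p' = hcr.below := Fin.ext h6
      subst h4 h5 h7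
      rcases h3 with rfl | rfl
      · exact (h2 c hc hcr).1
      · exact (h2 c hc hcr).2

end NiceEmbedding

/-! ### Two counting principles: involutions, and ends of paths -/

theorem even_card_of_involution {α : Type*} (s : Finset α) (f : α → α)
    (hs : ∀ a ∈ s, f a ∈ s) (hf : ∀ a ∈ s, f (f a) = a) (hne : ∀ a ∈ s, f a ≠ a) :
    Even #s := by
  have h : ∑ a ∈ s, (1 : ZMod 2) = 0 :=
    Finset.sum_involution (fun a _ => f a) (fun a _ => by decide) (fun a ha _ => hne a ha)
      (fun a ha => hs a ha) (fun a ha => hf a ha)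
  rw [Finset.sum_const, nsmul_eq_mul, mul_one] at h
  exact (ZMod.natCast_eq_zero_iff_even).1 h

/-- In a graph of maximal degree at most two, a connected component contains at most two vertices
of degree at most one. -/
theorem not_three_ends {V : Type*} [Fintype V] (G : SimpleGraph V)
    (hG : ∀ v, #(G.neighborFinset v) ≤ 2) {a b c : V} (hab : a ≠ b) (hac : a ≠ c) (hbc : b ≠ c)
    (hrb : G.Reachable a b) (hrc : G.Reachable a c)
    (ha : #(G.neighborFinset a) ≤ 1) (hb : #(G.neighborFinset b) ≤ 1)
    (hc : #(G.neighborFinset c) ≤ 1) : False := by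
  set C := G.connectedComponentMk a
  have haC : a ∈ C := rfl
  have hbC : b ∈ C := (SimpleGraph.ConnectedComponent.sound hrb).symm
  have hcC : c ∈ C := (SimpleGraph.ConnectedComponent.sound hrc).symm
  have h1 := C.connected_toSimpleGraph.card_vert_le_card_edgeSet_add_one
  rw [Nat.card_eq_fintype_card, Nat.card_eq_fintype_card] at h1
  have h2 := C.toSimpleGraph.sum_degrees_eq_twice_card_edges
  rw [SimpleGraph.edgeFinset_card] at h2
  have hdeg : ∀ v : C, C.toSimpleGraph.degree v ≤ #(G.neighborFinset v) := fun v => by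
    rw [← SimpleGraph.card_neighborFinset_eq_degree]
    refine Finset.card_le_card_of_injOn Subtype.val ?_ Subtype.val_injective.injOn
    intro w hw
    simp only [Finset.mem_coe, SimpleGraph.mem_neighborFinset] at hw ⊢
    exact hw
  let T : Finset C := {⟨a, haC⟩, ⟨b, hbC⟩, ⟨c, hcC⟩}
  have hT : #T = 3 := Finset.card_eq_three.2 ⟨_, _, _, by simpa using hab, by simpa using hac,
    by simpa using hbc, rfl⟩
  -- The degrees sum to at most `2|V| - 3`, while connectedness gives at least `|V| - 1` edges.
  have h3 : ∑ v : C, (C.toSimpleGraph.degree v + if v ∈ T then 1 else 0) ≤ ∑ v : C, 2 := by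
    refine Finset.sum_le_sum fun v _ => ?_
    split_ifs with hv
    · simp only [T, Finset.mem_insert, Finset.mem_singleton] at hv
      have := hdeg v
      rcases hv with rfl | rfl | rfl <;> simp only at this <;> omega
    · exact (hdeg v).trans (hG v)
  rw [Finset.sum_add_distrib, h2, Finset.sum_boole, Finset.filter_mem_eq_inter,
    Finset.univ_inter, hT, Finset.sum_const, Finset.card_univ, smul_eq_mul] at h3
  simp only [Nat.cast_ofNat] at h3
  omega

/-! ### In an uncrossed drawing every boundary point has exactly one mate -/

namespace NiceEmbedding

variable {n : ℕ} {π : Matching (Fin (2 * n))} (E : NiceEmbedding π)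

/-- The arcs of the uncrossed drawing `x` between the lines `t` and `t + 1`. -/
def StepArc (x : Finset E.Site) (t : Fin E.length) (a b : E.Point) : Prop :=
  ((a.1 : ℕ) = t ∧ (b.1 : ℕ) = t + 1 ∧ (a.2 : ℕ) = b.2 ∧
    ∀ c ∈ x, c.1 = t → (a.2 : ℕ) ≠ c.2 ∧ (a.2 : ℕ) ≠ c.2 + 1) ∨
  (∃ c ∈ x, c.1 = t ∧ ((a.1 : ℕ) = t ∨ (a.1 : ℕ) = t + 1) ∧ (b.1 : ℕ) = a.1 ∧
    (a.2 : ℕ) = c.2 ∧ (b.2 : ℕ) = c.2 + 1)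

variable {E}

theorem exists_stepArc {x : Finset E.Site} {a b : E.Point} (h : E.Arc x a b) :
    ∃ t, E.StepArc x t a b := by
  rcases h with ⟨t, p, rfl, rfl, h⟩ | ⟨c, hc, h1, h2, h3, h4⟩
  · exact ⟨t, Or.inl ⟨by simp, by simp, rfl, h⟩⟩
  · refine ⟨c.1, Or.inr ⟨c, hc, rfl, ?_, congrArg _ h2, congrArg _ h3, h4⟩⟩
    rcases h1 with h1 | h1 <;> simp [h1]

theorem StepArc.line {x : Finset E.Site} {t : Fin E.length} {a b : E.Point}
    (h : E.StepArc x t a b) : ((a.1 : ℕ) = t ∨ (a.1 : ℕ) = t + 1) ∧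
      ((b.1 : ℕ) = t ∨ (b.1 : ℕ) = t + 1) := by
  rcases h with ⟨h1, h2, -⟩ | ⟨c, -, -, h1, h2, -⟩ <;> omega

/-- Crossings in one strip do not overlap, so a point meets at most one vertical uncrossing there,
and then no horizontal arc. Degrees are thus bounded by the number of adjacent strips. -/
theorem stepArc_unique {x : Finset E.Site} (hx : x ∈ E.uncrossings) {t : Fin E.length}
    {a b b' : E.Point} (h : E.StepArc x t a b ∨ E.StepArc x t b a)
    (h' : E.StepArc x t a b' ∨ E.StepArc x t b' a) : b = b' := by
  have key : ∀ c ∈ x, ∀ d ∈ x, c.1 = t → d.1 = t → (c.2 : ℕ) + 1 ≠ d.2 := fun c hc d hd h1 h2 =>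
    ((mem_uncrossings.1 hx).1 c hc).not_overlap ((mem_uncrossings.1 hx).1 d hd) (h1.trans h2.symm)
  suffices (b.1 : ℕ) = b'.1 ∧ (b.2 : ℕ) = b'.2 from Prod.ext (Fin.ext this.1) (Fin.ext this.2)
  rcases h with (⟨h1, h2, h3, h4⟩ | ⟨c, hc, h0, h1, h2, h3, h4⟩) |
    (⟨h1, h2, h3, h4⟩ | ⟨c, hc, h0, h1, h2, h3, h4⟩) <;>
  rcases h' with (⟨h1', h2', h3', h4'⟩ | ⟨c', hc', h0', h1', h2', h3', h4'⟩) |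
    (⟨h1', h2', h3', h4'⟩ | ⟨c', hc', h0', h1', h2', h3', h4'⟩) <;>
  first
  | omega
  | (have := h4 c' hc' h0'; omega)
  | (have := h4' c hc h0; omega)
  | (have := key c hc c' hc' h0 h0'; have := key c' hc' c hc h0' h0; omega)

theorem card_neighborFinset_le {x : Finset E.Site} (hx : x ∈ E.uncrossings) (a : E.Point) :
    #((E.graph x).neighborFinset a) ≤
      #{t : Fin E.length | (a.1 : ℕ) = t ∨ (a.1 : ℕ) = t + 1} := by
  have h : ∀ b, (E.graph x).Adj a b → ∃ t, E.StepArc x t a b ∨ E.StepArc x t b a := by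
    intro b hb
    rcases ((SimpleGraph.fromRel_adj _ _ _).1 hb).2 with h | h
    · obtain ⟨t, ht⟩ := exists_stepArc h; exact ⟨t, Or.inl ht⟩
    · obtain ⟨t, ht⟩ := exists_stepArc h; exact ⟨t, Or.inr ht⟩
  rcases isEmpty_or_nonempty (Fin E.length) with hemp | hne
  · rw [Finset.card_eq_zero.2]
    · exact Nat.zero_le _
    · rw [Finset.eq_empty_iff_forall_notMem]
      intro b hb
      obtain ⟨t, -⟩ := h b (by simpa using hb)
      exact hemp.elim t
  choose! f hf using h
  refine Finset.card_le_card_of_injOn f ?_ ?_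
  · intro b hb
    simp only [Finset.mem_coe, SimpleGraph.mem_neighborFinset] at hb
    simp only [Finset.coe_filter, Finset.mem_univ, true_and, Set.mem_ofPred_eq]
    rcases hf b hb with h | h
    · exact h.line.1
    · exact h.line.2
  · intro b hb b' hb' hbb
    simp only [Finset.mem_coe, SimpleGraph.mem_neighborFinset] at hb hb'
    have := hf b' hb'
    rw [← hbb] at this
    exact stepArc_unique hx (hf b hb) this

theorem card_neighborFinset_le_two {x : Finset E.Site} (hx : x ∈ E.uncrossings) (a : E.Point) :
    #((E.graph x).neighborFinset a) ≤ 2 := by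
  refine (card_neighborFinset_le hx a).trans ?_
  rw [← not_lt, Finset.two_lt_card]
  rintro ⟨t, ht, u, hu, v, hv, h⟩
  simp only [Finset.mem_filter, Finset.mem_univ, true_and, ne_eq, Fin.ext_iff] at *
  omega

theorem card_neighborFinset_boundary_le {x : Finset E.Site} (hx : x ∈ E.uncrossings)
    (u : Vertex n) : #((E.graph x).neighborFinset (E.boundary u)) ≤ 1 := by
  refine (card_neighborFinset_le hx _).trans ?_
  rw [Finset.card_le_one]
  intro t ht v hv
  simp only [Finset.mem_filter, Finset.mem_univ, true_and, Fin.ext_iff] at *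
  have := t.2
  have := v.2
  cases u <;> simp only [boundary, Fin.val_zero, Fin.val_last] at * <;> omega

/-- Without a strip, strand `i` would end at its starting place, making `i` its own partner. Hence
the two sides are different lines. -/
theorem length_pos (i : Fin (2 * n)) : 0 < E.length := by
  by_contra h
  have h1 := E.pos_last i
  have h0 : Fin.last E.length = 0 := by
    ext; simp only [Fin.val_last, Fin.val_zero]; omega
  rw [h0, E.pos_zero] at h1
  exact π.partner_ne i h1.symm

theorem boundary_injective : Function.Injective (E.boundary) := by
  rintro (i | i) (j | j) h <;> simp only [boundary, Prod.mk.injEq, Sum.inl.injEq,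
    Sum.inr.injEq, reduceCtorEq, Fin.ext_iff, Fin.val_zero, Fin.val_last] at h ⊢
  · exact h.2
  · have := E.length_pos i; omega
  · have := E.length_pos i; omega
  · exact h.2

/-- The number of places above the cut `p` at which `P` holds on a line changes by an even number
from line `t` to line `t + 1`, unless the cut goes through a vertical uncrossing. -/
theorem cut_parity {x : Finset E.Site} (hx : x ∈ E.uncrossings) {P : E.Point → Prop}
    (hP : ∀ a b, E.Arc x a b → (P a ↔ P b)) (t : Fin E.length) :
    ∀ p : ℕ, p ≤ 2 * n → (∀ c ∈ x, c.1 = t → (c.2 : ℕ) + 1 ≠ p) →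
      (Even #{q : Fin (2 * n) | (q : ℕ) < p ∧ P (t.castSucc, q)} ↔
        Even #{q : Fin (2 * n) | (q : ℕ) < p ∧ P (t.succ, q)}) := by
  have succ_card : ∀ (s : Fin (E.length + 1)) (p : Fin (2 * n)),
      #{q : Fin (2 * n) | (q : ℕ) < p + 1 ∧ P (s, q)} =
        #{q : Fin (2 * n) | (q : ℕ) < p ∧ P (s, q)} + if P (s, p) then 1 else 0 := by
    intro s p
    split_ifs with h
    · rw [← Finset.card_insert_of_notMem (a := p) (by simp)]
      congr 1
      ext q
      simp only [Finset.mem_filter, Finset.mem_univ, true_and, Finset.mem_insert, Fin.ext_iff]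
      constructor
      · rintro ⟨h1, h2⟩
        by_cases h3 : (q : ℕ) = p
        · exact Or.inl h3
        · exact Or.inr ⟨by omega, h2⟩
      · rintro (h1 | ⟨h1, h2⟩)
        · exact ⟨by omega, by rwa [Fin.ext h1]⟩
        · exact ⟨by omega, h2⟩
    · rw [add_zero]
      congr 1
      ext q
      simp only [Finset.mem_filter, Finset.mem_univ, true_and]
      refine and_congr_left fun h2 => ?_
      have : (q : ℕ) ≠ p := fun h3 => h (by rwa [← Fin.ext h3])
      omega
  obtain ⟨hP1, hP2⟩ := (arc_closed_iff hx).1 hP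
  intro p
  induction p using Nat.strong_induction_on with
  | _ p ih =>
    intro hp hcut
    obtain _ | p := p
    · simp
    lift p to Fin (2 * n) using hp
    rw [succ_card, succ_card]
    -- The last two places may form a vertical uncrossing: `P` agrees on them on each line, so they
    -- contribute 0 or 2, and the induction goes back by two.
    by_cases h : ∃ c ∈ x, c.1 = t ∧ (c.2 : ℕ) + 1 = p
    · obtain ⟨c, hc, rfl, hcp⟩ := h
      have hcr := (mem_uncrossings.1 hx).1 c hc
      have hp' : p = hcr.below := Fin.ext hcp.symm
      have := hP2 c hc hcr
      rw [← hp'] at this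
      rw [← hcp, succ_card, succ_card]
      have ih' := ih c.2 (by omega) (by omega) fun d hd hdt h =>
        ((mem_uncrossings.1 hx).1 d hd).not_overlap hcr hdt h
      simp only [this.1, this.2]
      split_ifs <;> simpa [Nat.even_add] using ih'
    · push Not at h
      have ih' := ih p (by omega) (by omega) h
      have := hP1 t p fun c hc hct => by
        have h1 := hcut c hc hct
        have h2 := h c hc hct
        omega
      rw [Nat.even_add, Nat.even_add, ih', if_congr this rfl rfl]

/-- The boundary points that are joined to a given boundary point, the latter included. -/
def joined (x : Finset E.Site) (u : Vertex n) : Finset (Vertex n) :=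
  {v | (E.graph x).Reachable (E.boundary u) (E.boundary v)}

theorem mem_joined {x : Finset E.Site} {u v : Vertex n} :
    v ∈ E.joined x u ↔ (E.graph x).Reachable (E.boundary u) (E.boundary v) := by
  simp [joined]

theorem cut_parity_full {x : Finset E.Site} (hx : x ∈ E.uncrossings) {P : E.Point → Prop}
    (hP : ∀ a b, E.Arc x a b → (P a ↔ P b)) (s : Fin (E.length + 1)) :
    (Even #{q : Fin (2 * n) | P (0, q)} ↔ Even #{q : Fin (2 * n) | P (s, q)}) := by
  induction s using Fin.induction with
  | zero => rfl
  | succ t ih =>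
    rw [ih]
    have := cut_parity hx hP t (2 * n) le_rfl fun c hc _ h => by
      have := ((mem_uncrossings.1 hx).1 c hc).lt
      omega
    simpa using this

/-- A component meets the left and the right side in numbers of points of equal parity: apply the
cut below all places. -/
theorem even_card_joined {x : Finset E.Site} (hx : x ∈ E.uncrossings) (u : Vertex n) :
    Even #(E.joined x u) := by
  have h := cut_parity_full hx (P := fun a => (E.graph x).Reachable (E.boundary u) a)
    (fun a b hab => ⟨fun h => h.trans (reachable_of_arc hab),
      fun h => h.trans (reachable_of_arc hab).symm⟩) (Fin.last _)
  have hc : #(E.joined x u) = #{q : Fin (2 * n) | (E.graph x).Reachable (E.boundary u) (0, q)} +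
      #{q : Fin (2 * n) | (E.graph x).Reachable (E.boundary u) (Fin.last _, q)} := by
    rw [joined, Finset.card_filter, Finset.card_filter, Finset.card_filter,
      Fintype.sum_sum_type]
    rfl
  rw [hc, Nat.even_add]
  convert h

/-- Degrees bound the number of joined boundary points by two; parity excludes that the point is
alone. -/
theorem exists_joined_eq_pair {x : Finset E.Site} (hx : x ∈ E.uncrossings) (u : Vertex n) :
    ∃ v, v ≠ u ∧ E.joined x u = {u, v} := by
  have hu : u ∈ E.joined x u := mem_joined.2 (SimpleGraph.Reachable.refl _)
  have h3 : #(E.joined x u) ≤ 2 := by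
    rw [← not_lt, Finset.two_lt_card]
    rintro ⟨a, ha, b, hb, c, hc, hab, hac, hbc⟩
    rw [mem_joined] at ha hb hc
    exact not_three_ends (E.graph x) (card_neighborFinset_le_two hx)
      (boundary_injective.ne hab) (boundary_injective.ne hac) (boundary_injective.ne hbc)
      (ha.symm.trans hb) (ha.symm.trans hc) (card_neighborFinset_boundary_le hx a)
      (card_neighborFinset_boundary_le hx b) (card_neighborFinset_boundary_le hx c)
  have h2 : #(E.joined x u) = 2 := by
    have := Finset.card_pos.2 ⟨u, hu⟩
    obtain ⟨k, hk⟩ := even_card_joined hx u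
    omega
  obtain ⟨a, b, hab, h⟩ := Finset.card_eq_two.1 h2
  rw [h] at hu ⊢
  simp only [Finset.mem_insert, Finset.mem_singleton] at hu
  rcases hu with rfl | rfl
  · exact ⟨b, hab.symm, rfl⟩
  · exact ⟨a, hab, Finset.pair_comm _ _⟩

end NiceEmbedding

/-! ### The mates form a symmetric non-crossing diagram -/

theorem rank_injective : Function.Injective (Vertex.rank (n := n)) := by
  rintro (i | i) (j | j) h <;> simp only [Vertex.rank, Sum.inl.injEq, Sum.inr.injEq,
    reduceCtorEq, Fin.ext_iff] at h ⊢ <;> omega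

namespace NiceEmbedding

variable {n : ℕ} {π : Matching (Fin (2 * n))} {E : NiceEmbedding π}

/-- The other end of the strand of the uncrossed drawing that starts at `u`. -/
def mate {x : Finset E.Site} (hx : x ∈ E.uncrossings) (u : Vertex n) : Vertex n :=
  (exists_joined_eq_pair hx u).choose

theorem mate_ne {x : Finset E.Site} (hx : x ∈ E.uncrossings) (u : Vertex n) : mate hx u ≠ u :=
  (exists_joined_eq_pair hx u).choose_spec.1

theorem reachable_boundary_iff {x : Finset E.Site} (hx : x ∈ E.uncrossings) {u v : Vertex n} :
    (E.graph x).Reachable (E.boundary u) (E.boundary v) ↔ v = u ∨ v = mate hx u := by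
  rw [← mem_joined, (exists_joined_eq_pair hx u).choose_spec.2, mem_insert, mem_singleton]
  rfl

theorem reachable_mate {x : Finset E.Site} (hx : x ∈ E.uncrossings) (u : Vertex n) :
    (E.graph x).Reachable (E.boundary u) (E.boundary (mate hx u)) :=
  (reachable_boundary_iff hx).2 (Or.inr rfl)

theorem mate_eq_of_reachable {x : Finset E.Site} (hx : x ∈ E.uncrossings) {u v : Vertex n}
    (huv : u ≠ v) (h : (E.graph x).Reachable (E.boundary u) (E.boundary v)) : mate hx u = v :=
  (((reachable_boundary_iff hx).1 h).resolve_left huv.symm).symm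

theorem mate_involutive {x : Finset E.Site} (hx : x ∈ E.uncrossings) :
    Function.Involutive (mate hx) := fun u =>
  mate_eq_of_reachable hx (mate_ne hx u) (reachable_mate hx u).symm

theorem mate_swap {x : Finset E.Site} (hx : x ∈ E.uncrossings) (u : Vertex n) :
    mate hx u.swap = (mate hx u).swap := by
  refine mate_eq_of_reachable hx (fun h => mate_ne hx u ?_) ?_
  · have := congrArg Sum.swap h
    simpa using this.symm
  · have := reachable_mirror hx (reachable_mate hx u)
    rwa [pointMirror_boundary, pointMirror_boundary] at this

/-- The strand from `u` separates the boundary points of rank between those of `u` and its mate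
from the others. -/
theorem mate_noncrossing {x : Finset E.Site} (hx : x ∈ E.uncrossings) (u v : Vertex n) :
    ¬ (u.rank < v.rank ∧ v.rank < (mate hx u).rank ∧ (mate hx u).rank < (mate hx v).rank) := by
  rintro ⟨h1, h2, h3⟩
  let C : E.Point → Prop := fun a => (E.graph x).Reachable (E.boundary u) a
  have hC : ∀ a b, E.Arc x a b → (C a ↔ C b) := fun a b hab =>
    ⟨fun h => h.trans (reachable_of_arc hab), fun h => h.trans (reachable_of_arc hab).symm⟩
  let N : E.Point → ℕ := fun a => #{q : Fin (2 * n) | (q : ℕ) < (a.2 : ℕ) ∧ C (a.1, q)}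
  -- One side of the strand consists of the points off it with an even number of its component's
  -- points above them on their line. No arc changes sides: along horizontal arcs by `cut_parity`,
  -- and at a vertical uncrossing because nothing lies between its two places.
  have hH : ∀ a b, E.Arc x a b → ((¬ C a ∧ Even (N a)) ↔ (¬ C b ∧ Even (N b))) := by
    rw [arc_closed_iff hx] at hC ⊢
    constructor
    · intro t p hp
      rw [hC.1 t p hp]
      refine and_congr_right fun _ => ?_
      convert cut_parity hx ((arc_closed_iff hx).2 hC) t p p.2.le fun c hc hct =>
        (hp c hc hct).2.symm
    · have aux : ∀ (s : Fin (E.length + 1)) (p q : Fin (2 * n)), (q : ℕ) = p + 1 →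
          (C (s, p) ↔ C (s, q)) →
          ((¬ C (s, p) ∧ Even (N (s, p))) ↔ (¬ C (s, q) ∧ Even (N (s, q)))) := by
        intro s p q hpq h
        rw [h]
        refine and_congr_right fun hq => ?_
        have : N (s, p) = N (s, q) := by
          simp only [N]
          congr 1
          ext r
          simp only [mem_filter, mem_univ, true_and]
          refine and_congr_left fun hr => ?_
          have : (r : ℕ) ≠ p := fun hrp => hq (h.1 (by rwa [← Fin.ext hrp]))
          omega
        rw [this]
      intro c hc hcr
      exact ⟨aux _ _ _ rfl (hC.2 c hc hcr).1, aux _ _ _ rfl (hC.2 c hc hcr).2⟩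
  have hb : ∀ w : Vertex n, C (E.boundary w) ↔ w = u ∨ w = mate hx u := fun w =>
    reachable_boundary_iff hx
  have hum : u ≠ mate hx u := (mate_ne hx u).symm
  -- Ranks increase upwards on the right side, so "above" means smaller rank on the left and larger
  -- rank on the right.
  have hN : ∀ w : Vertex n,
      N (E.boundary w) = #{z ∈ ({u, mate hx u} : Finset (Vertex n)) | z.rank < w.rank} ∨
      N (E.boundary w) = #{z ∈ ({u, mate hx u} : Finset (Vertex n)) | w.rank < z.rank} := by
    rintro (i | i)
    · left
      simp only [N]
      rw [← card_map (⟨Sum.inl, Sum.inl_injective⟩ : Fin (2 * n) ↪ Vertex n)]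
      congr 1
      ext z
      simp only [mem_map, mem_filter, Function.Embedding.coeFn_mk, mem_insert, mem_singleton,
        boundary]
      constructor
      · rintro ⟨q, hq, rfl⟩
        obtain ⟨-, h1, h2⟩ := mem_filter.1 hq
        exact ⟨(hb (Sum.inl q)).1 h2, h1⟩
      · rintro ⟨h1, h2⟩
        rcases z with q | q
        · exact ⟨q, mem_filter.2 ⟨mem_univ _, h2, (hb (Sum.inl q)).2 h1⟩, rfl⟩
        · simp only [Vertex.rank] at h2; omega
    · right
      simp only [N]
      rw [← card_map (⟨Sum.inr, Sum.inr_injective⟩ : Fin (2 * n) ↪ Vertex n)]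
      congr 1
      ext z
      simp only [mem_map, mem_filter, Function.Embedding.coeFn_mk, mem_insert, mem_singleton,
        boundary]
      constructor
      · rintro ⟨q, hq, rfl⟩
        obtain ⟨-, h1, h2⟩ := mem_filter.1 hq
        exact ⟨(hb (Sum.inr q)).1 h2, by simp only [Vertex.rank]; omega⟩
      · rintro ⟨h1, h2⟩
        rcases z with q | q
        · simp only [Vertex.rank] at h2; omega
        · exact ⟨q, mem_filter.2 ⟨mem_univ _, by simp only [Vertex.rank] at h2; omega,
            (hb (Sum.inr q)).2 h1⟩, rfl⟩
  have hv : ¬ C (E.boundary v) := by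
    rw [hb]
    rintro (rfl | rfl) <;> omega
  have hm : ¬ C (E.boundary (mate hx v)) := by
    rw [hb]
    rintro (h | h) <;> rw [h] at h3 <;> omega
  have hv1 : N (E.boundary v) = 1 := by
    rcases hN v with h | h <;> rw [h, card_filter, sum_pair hum]
    · rw [if_pos h1, if_neg (by omega)]
    · rw [if_neg (by omega), if_pos h2]
  have hm1 : Even (N (E.boundary (mate hx v))) := by
    rcases hN (mate hx v) with h | h <;> rw [h, card_filter, sum_pair hum]
    · rw [if_pos (by omega), if_pos h3]; decide
    · rw [if_neg (by omega), if_neg (by omega)]; decide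
  have := (mem_iff_of_reachable hH (reachable_mate hx v)).2 ⟨hm, hm1⟩
  rw [hv1] at this
  exact absurd this.2 (by decide)

/-- The diagram `D(x)`. -/
def diagram {x : Finset E.Site} (hx : x ∈ E.uncrossings) : SymDiagram n where
  matching := Matching.ofInvolutive (mate hx) (mate_involutive hx) (mate_ne hx)
  noncrossing u v := mate_noncrossing hx u v
  symmetric u := mate_swap hx u

theorem hasDiagram_iff {x : Finset E.Site} (hx : x ∈ E.uncrossings) {D : SymDiagram n} :
    E.HasDiagram x D ↔ D = diagram hx := by
  constructor
  · intro h
    refine SymDiagram.ext (Matching.ext_partner fun u => ?_)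
    exact ((h u (mate hx u) (mate_ne hx u).symm).1 (reachable_mate hx u))
  · rintro rfl u v huv
    exact ⟨mate_eq_of_reachable hx huv, fun h => h ▸ reachable_mate hx u⟩

end NiceEmbedding

/-! ### Parity of ranks -/

theorem exists_rank_eq {n : ℕ} {r : ℕ} (hr : r < 4 * n) : ∃ v : Vertex n, v.rank = r := by
  by_cases h : r < 2 * n
  · exact ⟨Sum.inl ⟨r, h⟩, rfl⟩
  · exact ⟨Sum.inr ⟨4 * n - 1 - r, by omega⟩, by simp only [Vertex.rank]; omega⟩

theorem rank_lt {n : ℕ} (v : Vertex n) : v.rank < 4 * n := by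
  rcases v with i | i <;> simp only [Vertex.rank] <;> omega

theorem even_rank_swap {n : ℕ} (v : Vertex n) : Even (Vertex.rank v.swap) ↔ ¬ Even v.rank := by
  rcases v with i | i <;> simp only [Vertex.rank, Sum.swap_inl, Sum.swap_inr,
    Nat.even_iff] <;> omega

namespace SymDiagram

variable {n : ℕ} (D : SymDiagram n)

@[simp] theorem partner_partner (u : Vertex n) : D.partner (D.partner u) = u :=
  D.matching.partner_partner u

theorem partner_ne (u : Vertex n) : D.partner u ≠ u := D.matching.partner_ne u

/-- An edge of a diagram joins points of ranks of different parity. -/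
theorem even_rank_partner (u : Vertex n) :
    Even (D.partner u).rank ↔ ¬ Even u.rank := by
  have key : ∀ u : Vertex n, u.rank < (D.partner u).rank →
      (Even (D.partner u).rank ↔ ¬ Even u.rank) := by
    intro u hu
    -- The points strictly between the ends of an edge are matched among themselves, so their number
    -- is even.
    let s : Finset (Vertex n) := {w | u.rank < w.rank ∧ w.rank < (D.partner u).rank}
    have h1 : Even #s := by
      refine even_card_of_involution s D.partner (fun w hw => ?_) (fun w _ => D.partner_partner w)
        (fun w _ => D.partner_ne w)
      simp only [s, mem_filter, mem_univ, true_and] at hw ⊢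
      have h1 := D.noncrossing u w
      have h2 := D.noncrossing (D.partner w) u
      change ¬ (_ ∧ _ < (D.partner u).rank ∧ (D.partner u).rank < (D.partner w).rank) at h1
      change ¬ (_ ∧ _ < (D.partner (D.partner w)).rank ∧
        (D.partner (D.partner w)).rank < (D.partner u).rank) at h2
      rw [partner_partner] at h2
      have h3 : (D.partner w).rank ≠ u.rank := fun h => by
        have := rank_injective h
        rw [← this, partner_partner] at hw
        omega
      have h4 : (D.partner w).rank ≠ (D.partner u).rank := fun h => by
        have := congrArg D.partner (rank_injective h)
        rw [partner_partner, partner_partner] at this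
        rw [this] at hw
        omega
      omega
    have h2 : s.image Vertex.rank = Ioo u.rank (D.partner u).rank := by
      ext r
      simp only [s, mem_image, mem_filter, mem_univ, true_and, mem_Ioo]
      constructor
      · rintro ⟨w, hw, rfl⟩; exact hw
      · intro hr
        obtain ⟨w, rfl⟩ := exists_rank_eq (n := n) (hr.2.trans (rank_lt _))
        exact ⟨w, hr, rfl⟩
    have h3 := congrArg Finset.card h2
    rw [card_image_of_injective _ rank_injective, Nat.card_Ioo] at h3
    rw [h3, Nat.even_iff] at h1
    rw [Nat.even_iff, Nat.even_iff]
    omega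
  rcases lt_trichotomy u.rank (D.partner u).rank with h | h | h
  · exact key u h
  · exact absurd (rank_injective h).symm (D.partner_ne u)
  · have := key (D.partner u) (by rwa [partner_partner])
    rw [partner_partner] at this
    tauto

end SymDiagram

/-! ### Orientations of an uncrossed drawing -/

namespace NiceEmbedding

variable {n : ℕ} {π : Matching (Fin (2 * n))} {E : NiceEmbedding π}

variable (E) in
/-- The orientations of the strands and loops of `x` that reflect to their opposites and leave the
black boundary points, recorded by the set of the points at which the orientation from left to
right agrees with the parity of the place. -/
def IsColouring (I : Finset (Fin (2 * n))) (x : Finset E.Site) (G : Finset E.Point) : Prop :=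
  (∀ a b, E.Arc x a b → (a ∈ G ↔ b ∈ G)) ∧ (∀ a, E.pointMirror a ∈ G ↔ a ∈ G) ∧
    ∀ i : Fin (2 * n), ((0 : Fin (E.length + 1)), i) ∈ G ↔ (i ∈ I ↔ Even (i : ℕ))

theorem IsColouring.boundary_mem {I : Finset (Fin (2 * n))} {x : Finset E.Site}
    {G : Finset E.Point} (h : E.IsColouring I x G) (u : Vertex n) :
    E.boundary u ∈ G ↔ (SymDiagram.IsBlack I u ↔ Even u.rank) := by
  rcases u with i | i
  · exact h.2.2 i
  · have h1 := h.2.1 (E.boundary (Sum.inl i))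
    rw [pointMirror_boundary] at h1
    have h2 := even_rank_swap (Sum.inl i : Vertex n)
    have h3 := h.2.2 i
    simp only [Sum.swap_inl, boundary, SymDiagram.IsBlack] at *
    rw [h1, h3, h2]
    simp only [Vertex.rank]
    tauto

/-- The ends of a strand agree in `G` but have ranks of opposite parity, so by `boundary_mem` their
colours differ. -/
theorem IsColouring.compatible {I : Finset (Fin (2 * n))} {x : Finset E.Site}
    {G : Finset E.Point} (hG : E.IsColouring I x G) (hx : x ∈ E.uncrossings) :
    (diagram hx).Compatible I := by
  intro u
  have h1 := mem_iff_of_reachable hG.1 (reachable_mate hx u)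
  rw [hG.boundary_mem, hG.boundary_mem] at h1
  have h2 := (diagram hx).even_rank_partner u
  change Even (mate hx u).rank ↔ _ at h2
  change SymDiagram.IsBlack I u ↔ ¬ SymDiagram.IsBlack I (mate hx u)
  tauto

/-- The smallest colouring: no loop belongs to it. -/
def leastColouring (I : Finset (Fin (2 * n))) (x : Finset E.Site) : Finset E.Point :=
  {a | ∃ u, (E.graph x).Reachable (E.boundary u) a ∧ (SymDiagram.IsBlack I u ↔ Even u.rank)}

theorem isColouring_leastColouring {I : Finset (Fin (2 * n))} {x : Finset E.Site}
    (hx : x ∈ E.uncrossings) (h : (diagram hx).Compatible I) :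
    E.IsColouring I x (leastColouring I x) := by
  refine ⟨fun a b hab => ?_, ?_, fun i => ?_⟩
  · simp only [leastColouring, mem_filter, mem_univ, true_and]
    refine exists_congr fun u => and_congr_left fun _ => ?_
    exact ⟨fun h => h.trans (reachable_of_arc hab), fun h => h.trans (reachable_of_arc hab).symm⟩
  · have key : ∀ a, a ∈ leastColouring I x → E.pointMirror a ∈ leastColouring I x := by
      intro a ha
      simp only [leastColouring, mem_filter, mem_univ, true_and] at ha ⊢
      obtain ⟨u, hu, hb⟩ := ha
      refine ⟨u.swap, ?_, ?_⟩
      · rw [← pointMirror_boundary]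
        exact reachable_mirror hx hu
      · rw [even_rank_swap, ← hb]
        rcases u with i | i <;> simp [SymDiagram.IsBlack]
    exact fun a => ⟨fun h => by simpa using key _ h, key a⟩
  · simp only [leastColouring, mem_filter, mem_univ, true_and]
    constructor
    · rintro ⟨u, hu, hb⟩
      rcases (reachable_boundary_iff hx (v := Sum.inl i)).1 hu with rfl | hm
      · exact hb
      · have h1 := h u
        have h2 := (diagram hx).even_rank_partner u
        change Even (mate hx u).rank ↔ _ at h2
        change SymDiagram.IsBlack I u ↔ ¬ SymDiagram.IsBlack I (mate hx u) at h1
        rw [← hm] at h1 h2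
        simp only [SymDiagram.IsBlack, Vertex.rank] at h1 h2
        simp only [SymDiagram.IsBlack] at hb
        tauto
    · intro hi
      exact ⟨Sum.inl i, SimpleGraph.Reachable.refl _, hi⟩

variable (E) in
/-- The closed loops of `x`, each united with its mirror image. -/
def loopSets (x : Finset E.Site) : Set (Set E.Point) :=
  {s : Set E.Point | ∃ C : (E.graph x).ConnectedComponent,
    (∀ v : Vertex n, E.boundary v ∉ C.supp) ∧ s = C.supp ∪ E.pointMirror '' C.supp}

variable (E) in
/-- The component of a point, united with its mirror image. -/
def orbit (x : Finset E.Site) (a : E.Point) : Set E.Point :=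
  {b | (E.graph x).Reachable a b ∨ (E.graph x).Reachable a (E.pointMirror b)}

theorem mem_loopSets {x : Finset E.Site} {s : Set E.Point} :
    s ∈ E.loopSets x ↔ ∃ a, (∀ v, ¬ (E.graph x).Reachable a (E.boundary v)) ∧
      s = E.orbit x a := by
  have hsupp : ∀ a b, b ∈ ((E.graph x).connectedComponentMk a).supp ↔
      (E.graph x).Reachable a b := fun a b => by
    rw [SimpleGraph.ConnectedComponent.mem_supp_iff, SimpleGraph.ConnectedComponent.eq]
    exact SimpleGraph.reachable_comm
  have horb : ∀ a, ((E.graph x).connectedComponentMk a).supp ∪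
      E.pointMirror '' ((E.graph x).connectedComponentMk a).supp = E.orbit x a := by
    intro a
    ext b
    simp only [orbit, Set.mem_union, Set.mem_image, hsupp, Set.mem_ofPred_eq]
    refine or_congr_right ⟨?_, fun h => ⟨_, h, by simp⟩⟩
    rintro ⟨c, hc, rfl⟩
    simpa using hc
  constructor
  · rintro ⟨C, hC, rfl⟩
    induction C using SimpleGraph.ConnectedComponent.ind with
    | h a => exact ⟨a, fun v => by simpa only [hsupp] using hC v, horb a⟩
  · rintro ⟨a, ha, rfl⟩
    exact ⟨(E.graph x).connectedComponentMk a, fun v => by simpa only [hsupp] using ha v,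
      (horb a).symm⟩

theorem mem_orbit_self {x : Finset E.Site} (a : E.Point) : a ∈ E.orbit x a :=
  Or.inl (SimpleGraph.Reachable.refl _)

theorem orbit_eq {x : Finset E.Site} (hx : x ∈ E.uncrossings) {a b : E.Point}
    (h : b ∈ E.orbit x a) : E.orbit x b = E.orbit x a := by
  have hm : ∀ {a b : E.Point}, (E.graph x).Reachable (E.pointMirror a) b →
      (E.graph x).Reachable a (E.pointMirror b) := fun h => by
    simpa using reachable_mirror hx h
  ext c
  rcases h with h | h
  · exact or_congr ⟨h.trans, h.symm.trans⟩ ⟨h.trans, h.symm.trans⟩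
  · have h' : (E.graph x).Reachable b (E.pointMirror a) := (hm h.symm)
    constructor
    · rintro (h1 | h1)
      · exact Or.inr (hm (h'.symm.trans h1))
      · refine Or.inl ?_
        have := hm (h'.symm.trans h1)
        rwa [pointMirror_pointMirror] at this
    · rintro (h1 | h1)
      · exact Or.inr (hm (h.symm.trans h1))
      · refine Or.inl ?_
        have := hm (h.symm.trans h1)
        rwa [pointMirror_pointMirror] at this

theorem IsColouring.mem_iff_of_mem_orbit {I : Finset (Fin (2 * n))} {x : Finset E.Site}
    {G : Finset E.Point} (hG : E.IsColouring I x G) {a b : E.Point} (h : b ∈ E.orbit x a) :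
    b ∈ G ↔ a ∈ G := by
  rcases h with h | h
  · exact (mem_iff_of_reachable hG.1 h).symm
  · rw [← hG.2.1 b]
    exact (mem_iff_of_reachable hG.1 h).symm

/-- Colourings exist for compatible diagrams only, and then there is one for each choice of a set
of loops. -/
theorem card_colourings {I : Finset (Fin (2 * n))} {x : Finset E.Site} (hx : x ∈ E.uncrossings) :
    #{G : Finset E.Point | E.IsColouring I x G} =
      if (diagram hx).Compatible I then 2 ^ E.loops x else 0 := by
  split_ifs with h
  swap
  · rw [card_eq_zero, eq_empty_iff_forall_notMem]
    intro G hG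
    exact h ((mem_filter.1 hG).2.compatible hx)
  have h0 := isColouring_leastColouring hx h
  have hl : E.loops x = #(E.loopSets x).toFinite.toFinset := Set.ncard_eq_toFinset_card _ _
  rw [hl, ← card_powerset]
  symm
  have hnot : ∀ s ∈ E.loopSets x, ∀ a ∈ s, a ∉ leastColouring I x := by
    intro s hs a ha hG
    obtain ⟨b, hb, rfl⟩ := mem_loopSets.1 hs
    rw [h0.mem_iff_of_mem_orbit ha] at hG
    simp only [leastColouring, mem_filter, mem_univ, true_and] at hG
    obtain ⟨u, hu, -⟩ := hG
    exact hb u hu.symm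
  have horb : ∀ s ∈ E.loopSets x, ∀ a ∈ s, s = E.orbit x a := by
    intro s hs a ha
    obtain ⟨b, hb, rfl⟩ := mem_loopSets.1 hs
    exact (orbit_eq hx ha).symm
  -- On components with boundary points the colouring is forced; on the others it is constant on
  -- each loop together with its mirror image and otherwise arbitrary.
  refine card_bij (fun F _ => univ.filter fun a => a ∈ leastColouring I x ∨ ∃ s ∈ F, a ∈ s) ?_ ?_ ?_
  · intro F hF
    rw [mem_powerset] at hF
    have hF' : ∀ s ∈ F, s ∈ E.loopSets x := fun s hs => by simpa using hF hs
    have hFo : ∀ a b, b ∈ E.orbit x a → (∃ s ∈ F, a ∈ s) → ∃ s ∈ F, b ∈ s := by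
      rintro a b hab ⟨s, hs, ha⟩
      refine ⟨s, hs, ?_⟩
      rw [horb s (hF' s hs) a ha]
      exact hab
    have hFo' : ∀ a b, b ∈ E.orbit x a → ((∃ s ∈ F, a ∈ s) ↔ ∃ s ∈ F, b ∈ s) := fun a b hab =>
      ⟨hFo a b hab, hFo b a (by rw [orbit_eq hx hab]; exact mem_orbit_self a)⟩
    simp only [mem_filter, mem_univ, true_and]
    refine ⟨fun a b hab => ?_, fun a => ?_, fun i => ?_⟩
    · simp only [mem_filter, mem_univ, true_and]
      rw [h0.1 a b hab, hFo' a b (Or.inl (reachable_of_arc hab))]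
    · simp only [mem_filter, mem_univ, true_and]
      rw [h0.2.1 a, hFo' a _ (Or.inr (by rw [pointMirror_pointMirror]))]
    · simp only [mem_filter, mem_univ, true_and]
      rw [h0.2.2 i, or_iff_left]
      rintro ⟨s, hs, his⟩
      obtain ⟨b, hb, rfl⟩ := mem_loopSets.1 (hF' s hs)
      rcases his with h | h
      · exact hb (Sum.inl i) h
      · exact hb (Sum.inr i) (by simpa [pointMirror, boundary] using h)
  · have key : ∀ F F' : Finset (Set E.Point), F ⊆ (E.loopSets x).toFinite.toFinset →
        F' ⊆ (E.loopSets x).toFinite.toFinset →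
        (univ.filter fun a : E.Point => a ∈ leastColouring I x ∨ ∃ s ∈ F, a ∈ s) =
        (univ.filter fun a : E.Point => a ∈ leastColouring I x ∨ ∃ s ∈ F', a ∈ s) → F ⊆ F' := by
      intro F F' hF hF' hFF s hs
      have hsl : s ∈ E.loopSets x := by simpa using hF hs
      obtain ⟨b, hb, rfl⟩ := mem_loopSets.1 hsl
      have h1 : b ∈ (univ.filter fun a : E.Point => a ∈ leastColouring I x ∨ ∃ s ∈ F, a ∈ s) := by
        simp only [mem_filter, mem_univ, true_and]
        exact Or.inr ⟨_, hs, mem_orbit_self b⟩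
      rw [hFF] at h1
      simp only [mem_filter, mem_univ, true_and] at h1
      obtain ⟨s', hs', hb'⟩ := h1.resolve_left (hnot _ hsl b (mem_orbit_self b))
      rwa [← horb s' (by simpa using hF' hs') b hb']
    intro F hF F' hF' hFF
    rw [mem_powerset] at hF hF'
    exact (key F F' hF hF' hFF).antisymm (key F' F hF' hF hFF.symm)
  · intro G hG
    have hG := (mem_filter.1 hG).2
    refine ⟨(E.loopSets x).toFinite.toFinset.filter fun s => s ⊆ (G : Set E.Point),
      mem_powerset.2 (filter_subset _ _), ?_⟩
    ext a
    simp only [mem_filter, mem_univ, true_and, Set.Finite.mem_toFinset]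
    by_cases ha : ∃ u, (E.graph x).Reachable a (E.boundary u)
    · obtain ⟨u, hu⟩ := ha
      rw [or_iff_left, mem_iff_of_reachable h0.1 hu, mem_iff_of_reachable hG.1 hu,
        h0.boundary_mem, hG.boundary_mem]
      rintro ⟨s, ⟨hs, -⟩, has⟩
      obtain ⟨b, hb, rfl⟩ := mem_loopSets.1 hs
      rcases has with h | h
      · exact hb u (h.trans hu)
      · have := reachable_mirror hx hu
        rw [pointMirror_boundary] at this
        exact hb _ (h.trans this)
    · push Not at ha
      have hal : E.orbit x a ∈ E.loopSets x := mem_loopSets.2 ⟨a, ha, rfl⟩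
      rw [or_iff_right (hnot _ hal a (mem_orbit_self a))]
      constructor
      · rintro ⟨s, ⟨-, hs⟩, has⟩
        exact hs has
      · intro h
        exact ⟨_, ⟨hal, fun b hb => (hG.mem_iff_of_mem_orbit hb).2 h⟩, mem_orbit_self a⟩

end NiceEmbedding

/-! ### Cancellation at flat crossings -/

theorem neg_one_pow_card_symmDiff {α : Type*} [DecidableEq α] (s : Finset α) (a : α) :
    (-1 : ℤ) ^ #(symmDiff s {a}) = -(-1) ^ #s := by
  by_cases h : a ∈ s
  · have h1 : symmDiff s {a} = s.erase a := by
      ext b; simp only [mem_symmDiff, mem_singleton, mem_erase]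
      by_cases hb : b = a <;> simp [hb, h]
    have h2 := card_erase_add_one h
    rw [h1, ← h2, pow_succ]; ring
  · have h1 : symmDiff s {a} = insert a s := by
      ext b; simp only [mem_symmDiff, mem_singleton, mem_insert]
      by_cases hb : b = a <;> simp [hb, h]
    rw [h1, card_insert_of_notMem h, pow_succ]; ring

namespace NiceEmbedding

variable {n : ℕ} {π : Matching (Fin (2 * n))} {E : NiceEmbedding π}

variable (E) in
/-- The sign of an uncrossing. -/
def sign (x : Finset E.Site) : ℤ := (-1) ^ (E.unpairedVertical x + E.pairedHorizontal x)

/-- The sum of `f_D(π)` over the `I`-compatible diagrams, as a sum over all coloured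
uncrossings. -/
theorem sum_coeff_eq (I : Finset (Fin (2 * n))) :
    ∑ D : SymDiagram n with D.Compatible I, E.coeff D =
      ∑ G : Finset E.Point, ∑ x ∈ E.uncrossings with E.IsColouring I x G, E.sign x := by
  have h1 : ∑ D : SymDiagram n with D.Compatible I, E.coeff D =
      ∑ x ∈ E.uncrossings, ∑ D : SymDiagram n with D.Compatible I,
        if E.HasDiagram x D then E.weight x else 0 := by
    rw [sum_comm]
    exact sum_congr rfl fun D _ => by rw [coeff, sum_filter]
  have h2 : ∑ G : Finset E.Point, ∑ x ∈ E.uncrossings with E.IsColouring I x G, E.sign x =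
      ∑ x ∈ E.uncrossings, ∑ G : Finset E.Point, if E.IsColouring I x G then E.sign x else 0 := by
    rw [sum_comm]
    exact sum_congr rfl fun D _ => by rw [sum_filter]
  rw [h1, h2]
  refine sum_congr rfl fun x hx => ?_
  conv_rhs => rw [← sum_filter, sum_const, card_colourings hx]
  simp only [hasDiagram_iff hx]
  rw [sum_ite_eq']
  simp only [mem_filter, mem_univ, true_and, weight, sign]
  split_ifs <;> simp

variable (E) in
/-- The four points of a crossing are all in `G` or all outside. -/
def IsFlat (G : Finset E.Point) (c : E.Site) : Prop :=
  ∃ h : E.IsCrossing c, ((c.1.castSucc, c.2) ∈ G ↔ (c.1.castSucc, h.below) ∈ G) ∧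
    ((c.1.castSucc, c.2) ∈ G ↔ (c.1.succ, c.2) ∈ G) ∧
    ((c.1.castSucc, c.2) ∈ G ↔ (c.1.succ, h.below) ∈ G)

theorem IsFlat.mirror {G : Finset E.Point} (hG : ∀ a, E.pointMirror a ∈ G ↔ a ∈ G) {c : E.Site}
    (h : E.IsFlat G c) : E.IsFlat G (E.siteMirror c) := by
  obtain ⟨h0, h1, h2, h3⟩ := h
  have hm : ∀ (t : Fin (E.length + 1)) (p : Fin (2 * n)), (t.rev, p) ∈ G ↔ (t, p) ∈ G :=
    fun t p => hG (t, p)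
  refine ⟨isCrossing_siteMirror.2 h0, ?_⟩
  simp only [siteMirror, castSucc_rev, succ_rev, hm]
  change (_ ↔ (_, h0.below) ∈ G) ∧ _ ∧ (_ ↔ (_, h0.below) ∈ G)
  tauto

/-- Changing an uncrossing at `c` and its mirror image. -/
def toggle (c : E.Site) (x : Finset E.Site) : Finset E.Site := symmDiff x {c, E.siteMirror c}

theorem mem_toggle {c : E.Site} {x : Finset E.Site} {d : E.Site} :
    d ∈ toggle c x ↔ ¬ (d ∈ x ↔ (d = c ∨ d = E.siteMirror c)) := by
  simp only [toggle, mem_symmDiff, mem_insert, mem_singleton]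
  tauto

theorem toggle_toggle (c : E.Site) (x : Finset E.Site) : toggle c (toggle c x) = x := by
  simp [toggle]

theorem toggle_mem_uncrossings {c : E.Site} (hc : E.IsCrossing c) {x : Finset E.Site}
    (hx : x ∈ E.uncrossings) : toggle c x ∈ E.uncrossings := by
  rw [mem_uncrossings]
  constructor
  · intro d hd
    rw [mem_toggle] at hd
    by_cases hdx : d ∈ x
    · exact (mem_uncrossings.1 hx).1 d hdx
    · have : d = c ∨ d = E.siteMirror c := by tauto
      rcases this with rfl | rfl
      · exact hc
      · exact isCrossing_siteMirror.2 hc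
  · intro d hd
    rw [mem_toggle] at hd ⊢
    have h1 : E.siteMirror d = c ↔ d = E.siteMirror c :=
      ⟨fun h => by rw [← h, siteMirror_siteMirror], fun h => by rw [h, siteMirror_siteMirror]⟩
    have h2 : E.siteMirror d = E.siteMirror c ↔ d = c :=
      ⟨fun h => by rw [← siteMirror_siteMirror d, h, siteMirror_siteMirror], fun h => by rw [h]⟩
    rw [siteMirror_mem_iff hx, h1, h2]
    tauto

/-- All four points of a flat crossing agree in `G`, so either uncrossing joins agreeing points; by
symmetry of `G` the mirror crossing is flat too. -/
theorem isColouring_toggle {I : Finset (Fin (2 * n))} {x : Finset E.Site} {G : Finset E.Point}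
    (hx : x ∈ E.uncrossings) (hG : E.IsColouring I x G) {c : E.Site} (hc : E.IsFlat G c) :
    E.IsColouring I (toggle c x) G := by
  refine ⟨?_, hG.2⟩
  have hflat : ∀ d, (d = c ∨ d = E.siteMirror c) → E.IsFlat G d := by
    rintro d (rfl | rfl)
    · exact hc
    · exact hc.mirror hG.2.1
  obtain ⟨h1, h2⟩ := (arc_closed_iff hx).1 hG.1
  refine (arc_closed_iff (toggle_mem_uncrossings hc.1 hx)).2 ⟨fun t p hp => ?_, fun d hd h => ?_⟩
  · by_cases hx' : ∀ d ∈ x, d.1 = t → (p : ℕ) ≠ d.2 ∧ (p : ℕ) ≠ d.2 + 1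
    · exact h1 t p hx'
    · push Not at hx'
      obtain ⟨d, hdx, rfl, hpd⟩ := hx'
      have hd : d ∉ toggle c x := fun h => (hp d h rfl).2 (hpd (hp d h rfl).1)
      rw [mem_toggle] at hd
      obtain ⟨h3, h4, h5, h6⟩ := hflat d (by tauto)
      by_cases h7 : (p : ℕ) = d.2
      · rw [Fin.ext h7]; exact h5
      · have : p = h3.below := Fin.ext (hpd h7)
        rw [this]; tauto
  · rw [mem_toggle] at hd
    by_cases hdx : d ∈ x
    · exact h2 d hdx h
    · obtain ⟨h3, h4, h5, h6⟩ := hflat d (by tauto)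
      tauto

/-- On the axis `uv` changes by one, off the axis `ph` does. Since `ph` counts a pair by its left
member, a paired crossing has to be given by that one. -/
theorem sign_toggle {c : E.Site} (hc : E.IsCrossing c)
    (hax : E.IsUnpaired c ∨ c.1 < c.1.rev) (x : Finset E.Site) :
    E.sign (toggle c x) = - E.sign x := by
  by_cases hu : E.IsUnpaired c
  · have hcm := (isUnpaired_iff_axis.1 hu).2
    have h1 : ({d | E.IsUnpaired d ∧ d ∈ toggle c x} : Finset E.Site) =
        symmDiff ({d | E.IsUnpaired d ∧ d ∈ x} : Finset E.Site) {c} := by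
      ext d
      simp only [mem_filter, mem_univ, true_and, mem_symmDiff, mem_singleton, mem_toggle, hcm]
      by_cases hd : d = c
      · subst hd; tauto
      · tauto
    have h2 : ({d | E.IsPaired d ∧ d ∉ toggle c x ∧ d.1 < d.1.rev} : Finset E.Site) =
        ({d | E.IsPaired d ∧ d ∉ x ∧ d.1 < d.1.rev} : Finset E.Site) := by
      ext d
      simp only [mem_filter, mem_univ, true_and, mem_toggle, hcm]
      by_cases hd : d = c
      · subst hd; simp only [IsPaired]; tauto
      · tauto
    rw [sign, sign, unpairedVertical, unpairedVertical, pairedHorizontal, pairedHorizontal, h1, h2,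
      pow_add, neg_one_pow_card_symmDiff, pow_add, neg_mul]
  · have hlt := hax.resolve_left hu
    have hne : ∀ d : E.Site, d = E.siteMirror c → ¬ d.1 < d.1.rev := by
      rintro d rfl h
      simp only [siteMirror, Fin.rev_rev] at h
      exact lt_asymm h hlt
    have h1 : ({d | E.IsUnpaired d ∧ d ∈ toggle c x} : Finset E.Site) =
        ({d | E.IsUnpaired d ∧ d ∈ x} : Finset E.Site) := by
      ext d
      simp only [mem_filter, mem_univ, true_and, mem_toggle]
      refine and_congr_right fun hd => ?_
      have h3 : d ≠ c := fun h => hu (h ▸ hd)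
      have h4 : d ≠ E.siteMirror c := fun h => hu (isUnpaired_siteMirror.1 (h ▸ hd))
      tauto
    have h2 : ({d | E.IsPaired d ∧ d ∉ toggle c x ∧ d.1 < d.1.rev} : Finset E.Site) =
        symmDiff ({d | E.IsPaired d ∧ d ∉ x ∧ d.1 < d.1.rev} : Finset E.Site) {c} := by
      ext d
      have := hne d
      simp only [mem_filter, mem_univ, true_and, mem_symmDiff, mem_singleton, mem_toggle]
      by_cases hd : d = c
      · subst hd; simp only [IsPaired]; tauto
      · tauto
    rw [sign, sign, unpairedVertical, unpairedVertical, pairedHorizontal, pairedHorizontal, h1, h2,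
      pow_add, neg_one_pow_card_symmDiff, pow_add, mul_neg]

theorem IsCrossing.axis {c : E.Site} (hc : E.IsCrossing c) (h : c.1 = c.1.rev) :
    E.IsUnpaired c :=
  isUnpaired_iff_axis.2 ⟨hc, Prod.ext h.symm rfl⟩

/-- The contributions of a colouring with a flat crossing cancel. -/
theorem sum_sign_eq_zero {I : Finset (Fin (2 * n))} {G : Finset E.Point} {c : E.Site}
    (hc : E.IsFlat G c) : ∑ x ∈ E.uncrossings with E.IsColouring I x G, E.sign x = 0 := by
  by_cases hne : ∃ x, E.IsColouring I x G
  swap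
  · push Not at hne
    rw [filter_false_of_mem fun x _ => hne x, sum_empty]
  obtain ⟨x₀, hx₀⟩ := hne
  -- Replace the crossing by its mirror image if it lies right of the axis.
  have hd : ∃ d, E.IsFlat G d ∧ (E.IsUnpaired d ∨ d.1 < d.1.rev) := by
    rcases lt_trichotomy c.1 c.1.rev with h | h | h
    · exact ⟨c, hc, Or.inr h⟩
    · exact ⟨c, hc, Or.inl (hc.1.axis h)⟩
    · exact ⟨E.siteMirror c, hc.mirror hx₀.2.1, Or.inr (by simpa [siteMirror] using h)⟩
  obtain ⟨d, hd, hax⟩ := hd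
  refine Finset.sum_involution (fun x _ => toggle d x) ?_ ?_ ?_ ?_
  · intro x _
    rw [sign_toggle hd.1 hax, add_neg_cancel]
  · intro x _ _ h
    have : d ∈ toggle d x ↔ d ∈ x := by rw [h]
    rw [mem_toggle] at this
    tauto
  · intro x hx
    rw [mem_filter] at hx ⊢
    exact ⟨toggle_mem_uncrossings hd.1 hx.1, isColouring_toggle hx.1 hx.2 hd⟩
  · intro x _
    exact toggle_toggle d x

/-- The uncrossing pairs agreeing points; without flatness the two pairs disagree with each other,
which determines the uncrossing. Diagonally opposite points then differ in `G`; as the parity of the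
place also changes along a strand, this says that the direction runs straight through the crossing.
-/
theorem IsColouring.of_not_isFlat {I : Finset (Fin (2 * n))} {x : Finset E.Site}
    {G : Finset E.Point} (hG : E.IsColouring I x G) (hx : x ∈ E.uncrossings) {c : E.Site}
    (hc : E.IsCrossing c) (hf : ¬ E.IsFlat G c) :
    ((c.1.succ, hc.below) ∈ G ↔ (c.1.castSucc, c.2) ∉ G) ∧
      ((c.1.succ, c.2) ∈ G ↔ (c.1.castSucc, hc.below) ∉ G) ∧
      (c ∈ x ↔ ((c.1.castSucc, c.2) ∈ G ↔ (c.1.castSucc, hc.below) ∈ G)) := by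
  have hf' : ¬ (((c.1.castSucc, c.2) ∈ G ↔ (c.1.castSucc, hc.below) ∈ G) ∧
    ((c.1.castSucc, c.2) ∈ G ↔ (c.1.succ, c.2) ∈ G) ∧
    ((c.1.castSucc, c.2) ∈ G ↔ (c.1.succ, hc.below) ∈ G)) := fun h => hf ⟨hc, h⟩
  obtain ⟨h1, h2⟩ := (arc_closed_iff hx).1 hG.1
  by_cases hcx : c ∈ x
  · have := h2 c hcx hc
    tauto
  · have hne : ∀ d ∈ x, d.1 = c.1 → (d.2 : ℕ) ≠ c.2 := fun d hd h h' => hcx (by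
      rwa [← show d = c from Prod.ext h (Fin.ext h')])
    have h3 := h1 c.1 c.2 fun d hd hdc => ⟨(hne d hd hdc).symm,
      (((mem_uncrossings.1 hx).1 d hd).not_overlap hc hdc).symm⟩
    have h4 := h1 c.1 hc.below fun d hd hdc =>
      ⟨hc.not_overlap ((mem_uncrossings.1 hx).1 d hd) hdc.symm, fun h =>
        hne d hd hdc (by simp only [IsCrossing.below] at h; omega)⟩
    grind

/-! ### The surviving orientation and uncrossing -/

variable (E) in
/-- The orientation in which every edge of `ν(π)` starts at its black end. -/
def strandColouring (I : Finset (Fin (2 * n))) : Finset E.Point :=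
  {a | (E.pos a.1).symm a.2 ∈ I ↔ Even (a.2 : ℕ)}

variable (E) in
/-- The crossings between edges with different orientations. -/
def strandUncrossing (I : Finset (Fin (2 * n))) : Finset E.Site :=
  {c | E.IsCrossing c ∧ ¬ (E.upperStrand c ∈ I ↔ E.lowerStrand c ∈ I)}

theorem mem_strandColouring {I : Finset (Fin (2 * n))} {t : Fin (E.length + 1)}
    {i : Fin (2 * n)} :
    (t, E.pos t i) ∈ E.strandColouring I ↔ (i ∈ I ↔ Even (E.pos t i : ℕ)) := by
  simp [strandColouring]

theorem IsColouring.follows_strands {I : Finset (Fin (2 * n))} {x : Finset E.Site}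
    {G : Finset E.Point} (hG : E.IsColouring I x G) (hx : x ∈ E.uncrossings)
    (hf : ∀ c, ¬ E.IsFlat G c) (t : Fin (E.length + 1)) (i : Fin (2 * n)) :
    (t, E.pos t i) ∈ G ↔ (i ∈ I ↔ Even (E.pos t i : ℕ)) := by
  induction t using Fin.induction with
  | zero => rw [E.pos_zero]; exact hG.2.2 i
  | succ t ih =>
    have hs := E.step t i
    rcases lt_trichotomy (E.pos t.succ i : ℕ) (E.pos t.castSucc i : ℕ) with h | h | h
    -- A strand moving up is the lower strand of a crossing, whose site is named by the place the
    -- strand reaches.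
    · let c : E.Site := (t, E.pos t.succ i)
      have hl : E.lowerStrand c = i := by simp [lowerStrand, c]
      have hc : E.IsCrossing c := isCrossing_iff_lower.2 (by rw [hl]; simp only [c]; omega)
      have h1 := (hG.of_not_isFlat hx hc (hf c)).2.1
      have h2 : E.pos t.castSucc i = hc.below := by
        have := hc.pos_lower'
        rwa [hl] at this
      rw [← h2] at h1
      simp only [c] at h1
      rw [h1, ih]
      have h3 : (E.pos t.castSucc i : ℕ) = E.pos t.succ i + 1 := by omega
      rw [h3, Nat.even_add_one]
      tauto
    · have hp : E.pos t.succ i = E.pos t.castSucc i := Fin.ext h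
      rw [hp, ← ih]
      refine (((arc_closed_iff hx).1 hG.1).1 t _ fun c hc hct => ?_).symm
      have hcr := (mem_uncrossings.1 hx).1 c hc
      subst hct
      constructor
      · intro hc2
        have hu : E.upperStrand c = i := by
          rw [upperStrand, Equiv.symm_apply_eq]; exact Fin.ext hc2.symm
        have := hcr.pos_upper
        rw [hu] at this
        omega
      · intro hc2
        have hl : E.lowerStrand c = i := (E.pos c.1.castSucc).injective (by
          rw [hcr.pos_lower']; exact Fin.ext hc2.symm)
        have := E.pos_lowerStrand c
        rw [hl] at this
        rw [← this] at hc2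
        omega
    · let c : E.Site := (t, E.pos t.castSucc i)
      have hu : E.upperStrand c = i := by simp [upperStrand, c]
      have hc : E.IsCrossing c := by rw [IsCrossing, hu]; simp only [c]; omega
      have h1 := (hG.of_not_isFlat hx hc (hf c)).1
      have h2 : E.pos t.succ i = hc.below := by
        have := hc.pos_upper'
        rwa [hu] at this
      rw [← h2] at h1
      simp only [c] at h1
      rw [h1, ih]
      have h3 : (E.pos t.succ i : ℕ) = E.pos t.castSucc i + 1 := by omega
      rw [h3, Nat.even_add_one]
      tauto

theorem IsColouring.eq_strandColouring {I : Finset (Fin (2 * n))} {x : Finset E.Site}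
    {G : Finset E.Point} (hG : E.IsColouring I x G) (hx : x ∈ E.uncrossings)
    (hf : ∀ c, ¬ E.IsFlat G c) : G = E.strandColouring I := by
  ext ⟨t, p⟩
  obtain ⟨i, rfl⟩ := (E.pos t).surjective p
  rw [hG.follows_strands hx hf, mem_strandColouring]

theorem IsColouring.eq_strandUncrossing {I : Finset (Fin (2 * n))} {x : Finset E.Site}
    {G : Finset E.Point} (hG : E.IsColouring I x G) (hx : x ∈ E.uncrossings)
    (hf : ∀ c, ¬ E.IsFlat G c) : x = E.strandUncrossing I := by
  ext c
  have hcx : c ∈ x → E.IsCrossing c := (mem_uncrossings.1 hx).1 c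
  simp only [strandUncrossing, mem_filter, mem_univ, true_and]
  by_cases hc : E.IsCrossing c
  · have h1 := (hG.of_not_isFlat hx hc (hf c)).2.2
    have h2 := hG.follows_strands hx hf c.1.castSucc (E.upperStrand c)
    have h3 := hG.follows_strands hx hf c.1.castSucc (E.lowerStrand c)
    rw [hc.pos_lower, Nat.even_add_one, hc.pos_lower'] at h3
    rw [pos_upperStrand] at h2
    grind
  · tauto

/-- Strand `i` ends at `π(i)'`, where its direction is that of `i`; reflection compares it with the
one prescribed at `π(i)`. -/
theorem IsColouring.respects {I : Finset (Fin (2 * n))} {x : Finset E.Site}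
    {G : Finset E.Point} (hG : E.IsColouring I x G) (hx : x ∈ E.uncrossings)
    (hf : ∀ c, ¬ E.IsFlat G c) (i : Fin (2 * n)) : π.partner i ∈ I ↔ i ∈ I := by
  have h1 := hG.follows_strands hx hf (Fin.last _) i
  have h2 := hG.2.1 (0, π.partner i)
  rw [E.pos_last] at h1
  rw [hG.2.2] at h2
  simp only [pointMirror, Fin.rev_zero] at h2
  tauto

theorem strandUncrossing_mem {I : Finset (Fin (2 * n))} (hI : ∀ i, π.partner i ∈ I ↔ i ∈ I) :
    E.strandUncrossing I ∈ E.uncrossings := by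
  rw [mem_uncrossings]
  simp only [strandUncrossing, mem_filter, mem_univ, true_and]
  refine ⟨fun c hc => hc.1, fun c hc => ?_⟩
  rw [isCrossing_siteMirror, upperStrand_siteMirror, lowerStrand_siteMirror, hI, hI]
  tauto

/-- Equally directed strands can be uncrossed horizontally and oppositely directed ones vertically
without disturbing directions; symmetry holds because `π` respects `I`. -/
theorem isColouring_strandColouring {I : Finset (Fin (2 * n))}
    (hI : ∀ i, π.partner i ∈ I ↔ i ∈ I) :
    E.IsColouring I (E.strandUncrossing I) (E.strandColouring I) := by
  refine ⟨(arc_closed_iff (strandUncrossing_mem hI)).2 ⟨fun t p hp => ?_, fun c hc hcr => ?_⟩,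
    fun a => ?_, fun i => ?_⟩
  · obtain ⟨i, rfl⟩ := (E.pos t.castSucc).surjective p
    rw [mem_strandColouring]
    have hs := E.step t i
    rcases lt_trichotomy (E.pos t.succ i : ℕ) (E.pos t.castSucc i : ℕ) with h | h | h
    · let c : E.Site := (t, E.pos t.succ i)
      have hl : E.lowerStrand c = i := by simp [lowerStrand, c]
      have hc : E.IsCrossing c := isCrossing_iff_lower.2 (by rw [hl]; simp only [c]; omega)
      have h2 : E.pos t.castSucc i = hc.below := by
        have := hc.pos_lower'
        rwa [hl] at this
      have h3 : c ∉ E.strandUncrossing I := fun h3 => (hp c h3 rfl).2 (by simp only [c]; omega)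
      have h4 := hc.pos_upper'
      rw [← h2] at h4
      simp only [strandUncrossing, mem_filter, mem_univ, true_and, hl] at h3
      have h5 := mem_strandColouring (I := I) (t := t.succ) (i := E.upperStrand c)
      simp only [c] at h3 h4 h5 hc
      rw [h4] at h5
      grind
    · rw [show E.pos t.castSucc i = E.pos t.succ i from Fin.ext h.symm, mem_strandColouring]
    · let c : E.Site := (t, E.pos t.castSucc i)
      have hu : E.upperStrand c = i := by simp [upperStrand, c]
      have hc : E.IsCrossing c := by rw [IsCrossing, hu]; simp only [c]; omega
      have h3 : c ∉ E.strandUncrossing I := fun h3 => (hp c h3 rfl).1 (by simp only [c])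
      have h4 := E.pos_lowerStrand c
      simp only [strandUncrossing, mem_filter, mem_univ, true_and, hu] at h3
      simp only [c] at h4
      have h5 := mem_strandColouring (I := I) (t := t.succ) (i := E.lowerStrand c)
      simp only [c] at h3 h5 hc
      rw [h4] at h5
      grind
  · simp only [strandUncrossing, mem_filter, mem_univ, true_and] at hc
    have h1 := mem_strandColouring (I := I) (t := c.1.castSucc) (i := E.upperStrand c)
    have h2 := mem_strandColouring (I := I) (t := c.1.castSucc) (i := E.lowerStrand c)
    have h3 := mem_strandColouring (I := I) (t := c.1.succ) (i := E.upperStrand c)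
    have h4 := mem_strandColouring (I := I) (t := c.1.succ) (i := E.lowerStrand c)
    rw [hcr.pos_upper, Nat.even_add_one, hcr.pos_upper'] at h3
    rw [hcr.pos_lower, Nat.even_add_one, hcr.pos_lower'] at h2
    rw [pos_upperStrand] at h1
    rw [pos_lowerStrand] at h4
    grind
  · obtain ⟨t, p⟩ := a
    obtain ⟨i, rfl⟩ := (E.pos t).surjective p
    rw [mem_strandColouring, pointMirror]
    simp only
    rw [← E.mirror t i, mem_strandColouring, hI]
  · have := mem_strandColouring (E := E) (I := I) (t := 0) (i := i)
    rwa [E.pos_zero] at this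

/-- Along a strand through a crossing the direction persists while the parity of the place changes.
-/
theorem not_isFlat_strandColouring {I : Finset (Fin (2 * n))} (c : E.Site) :
    ¬ E.IsFlat (E.strandColouring I) c := by
  rintro ⟨hc, -, -, h⟩
  have h1 := mem_strandColouring (I := I) (t := c.1.castSucc) (i := E.upperStrand c)
  have h3 := mem_strandColouring (I := I) (t := c.1.succ) (i := E.upperStrand c)
  rw [hc.pos_upper, Nat.even_add_one, hc.pos_upper'] at h3
  rw [pos_upperStrand] at h1
  grind

theorem sum_coeff_eq_zero {I : Finset (Fin (2 * n))} (hI : ¬ ∀ i, π.partner i ∈ I ↔ i ∈ I) :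
    ∑ D : SymDiagram n with D.Compatible I, E.coeff D = 0 := by
  rw [sum_coeff_eq]
  refine sum_eq_zero fun G _ => ?_
  by_cases hf : ∃ c, E.IsFlat G c
  · obtain ⟨c, hc⟩ := hf
    exact sum_sign_eq_zero hc
  · push Not at hf
    refine sum_eq_zero fun x hx => ?_
    rw [mem_filter] at hx
    exact absurd (hx.2.respects hx.1 hf) hI

theorem sum_coeff_eq_sign {I : Finset (Fin (2 * n))} (hI : ∀ i, π.partner i ∈ I ↔ i ∈ I) :
    ∑ D : SymDiagram n with D.Compatible I, E.coeff D = E.sign (E.strandUncrossing I) := by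
  rw [sum_coeff_eq, sum_eq_single (E.strandColouring I), sum_eq_single (E.strandUncrossing I)]
  · intro x hx hne
    rw [mem_filter] at hx
    exact absurd (hx.2.eq_strandUncrossing hx.1 not_isFlat_strandColouring) hne
  · intro h
    exact absurd (mem_filter.2 ⟨strandUncrossing_mem hI, isColouring_strandColouring hI⟩) h
  · intro G _ hne
    by_cases hf : ∃ c, E.IsFlat G c
    · obtain ⟨c, hc⟩ := hf
      exact sum_sign_eq_zero hc
    · push Not at hf
      refine sum_eq_zero fun x hx => ?_
      rw [mem_filter] at hx
      exact absurd (hx.2.eq_strandColouring hx.1 hf) hne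
  · intro h
    exact absurd (mem_univ _) h

end NiceEmbedding

/-- Applied to the relative order of two strands, it turns a reversal between two lines into a
crossing in a strip between them. -/
theorem exists_change {L : ℕ} (P : Fin (L + 1) → Prop) (a b : Fin (L + 1)) (hab : a ≤ b)
    (h : ¬ (P a ↔ P b)) :
    ∃ t : Fin L, a ≤ t.castSucc ∧ t.succ ≤ b ∧ ¬ (P t.castSucc ↔ P t.succ) := by
  induction b using Fin.induction with
  | zero =>
    rw [Fin.le_zero_iff.1 hab] at h
    exact absurd Iff.rfl h
  | succ b ih =>
    rcases hab.eq_or_lt with rfl | hlt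
    · exact absurd Iff.rfl h
    · have hab' : a ≤ b.castSucc := Fin.le_castSucc_iff.2 hlt
      by_cases h' : P a ↔ P b.castSucc
      · exact ⟨b, hab', le_rfl, fun h2 => h (h'.trans h2)⟩
      · obtain ⟨t, h1, h2, h3⟩ := ih hab' h'
        exact ⟨t, h1, h2.trans (Fin.castSucc_lt_succ).le, h3⟩

/-! ### Inversions, crossings and nestings of a matching -/

namespace Matching

variable {α : Type*} [Fintype α] [LinearOrder α] (π : Matching α) (c : α → Prop)

/-- The inversions between different edges of the same colour. -/
def inversions : Finset (α × α) :=
  {p | p.1 < p.2 ∧ π.partner p.2 < π.partner p.1 ∧ p.2 ≠ π.partner p.1 ∧ (c p.1 ↔ c p.2)}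

/-- The pairs of crossing arcs of the same colour. -/
def crossings : Finset (α × α) :=
  {p | p.1 < p.2 ∧ p.2 < π.partner p.1 ∧ π.partner p.1 < π.partner p.2 ∧ (c p.1 ↔ c p.2)}

/-- The pairs of nested arcs of the same colour. -/
def nestings : Finset (α × α) :=
  {p | p.1 < p.2 ∧ p.2 < π.partner p.2 ∧ π.partner p.2 < π.partner p.1 ∧ (c p.1 ↔ c p.2)}

/-- Two arcs of equal colour give two inversions between them if they cross, four if they are
nested, and none if they lie side by side. -/
theorem card_inversions (hc : ∀ i, c (π.partner i) ↔ c i) :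
    #(π.inversions c) = 2 * #(π.crossings c) + 4 * #(π.nestings c) := by
  have hpp := π.partner_partner
  have hpi : ∀ i j, π.partner i = π.partner j → i = j := fun i j h => π.partner_injective h
  have hne := π.partner_ne
  -- Let the four ends be `a < b < c < d`. Crossing arcs have the inversions `(a, d)` (`e3`) and
  -- `(b, c)` (`e6`); nested arcs have `(a, b)`, `(c, d)`, `(a, c)`, `(b, d)` (`e1`, `e2`, `e4`,
  -- `e5`). The filters separate these six cases.
  have h1 := card_filter_add_card_filter_not (s := π.inversions c)
    (fun p => p.2 < π.partner p.2)
  have h2 := card_filter_add_card_filter_not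
    (s := (π.inversions c).filter fun p => ¬ p.2 < π.partner p.2)
    (fun p => p.1 < π.partner p.1)
  have h3 := card_filter_add_card_filter_not
    (s := ((π.inversions c).filter fun p => ¬ p.2 < π.partner p.2).filter
      fun p => p.1 < π.partner p.1)
    (fun p => p.1 < π.partner p.2)
  have h4 := card_filter_add_card_filter_not
    (s := (((π.inversions c).filter fun p => ¬ p.2 < π.partner p.2).filter
      fun p => p.1 < π.partner p.1).filter fun p => p.1 < π.partner p.2)
    (fun p => π.partner p.1 < p.2)
  have h5 := card_filter_add_card_filter_not
    (s := (((π.inversions c).filter fun p => ¬ p.2 < π.partner p.2).filter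
      fun p => p.1 < π.partner p.1).filter fun p => ¬ p.1 < π.partner p.2)
    (fun p => π.partner p.1 < p.2)
  have e1 : #((π.inversions c).filter fun p => p.2 < π.partner p.2) = #(π.nestings c) := by
    congr 1
    ext ⟨i, j⟩
    simp only [inversions, nestings, mem_filter, mem_univ, true_and]
    grind
  have e2 : #(((π.inversions c).filter fun p => ¬ p.2 < π.partner p.2).filter
      fun p => ¬ p.1 < π.partner p.1) = #(π.nestings c) := by
    refine card_nbij' (fun p => (π.partner p.2, π.partner p.1))
      (fun p => (π.partner p.2, π.partner p.1)) ?_ ?_ (fun p _ => by simp) (fun p _ => by simp)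
    all_goals
      rintro ⟨i, j⟩
      simp only [inversions, nestings, coe_filter, mem_filter, mem_univ, true_and,
        Set.mem_ofPred_eq, hpp, hc]
      grind
  have e3 : #(((((π.inversions c).filter fun p => ¬ p.2 < π.partner p.2).filter
      fun p => p.1 < π.partner p.1).filter fun p => p.1 < π.partner p.2).filter
      fun p => π.partner p.1 < p.2) = #(π.crossings c) := by
    refine card_nbij' (fun p => (p.1, π.partner p.2)) (fun p => (p.1, π.partner p.2)) ?_ ?_
      (fun p _ => by simp) (fun p _ => by simp)
    all_goals
      rintro ⟨i, j⟩
      simp only [inversions, crossings, coe_filter, mem_filter, mem_univ, true_and,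
        Set.mem_ofPred_eq, hpp, hc]
      grind
  have e4 : #(((((π.inversions c).filter fun p => ¬ p.2 < π.partner p.2).filter
      fun p => p.1 < π.partner p.1).filter fun p => p.1 < π.partner p.2).filter
      fun p => ¬ π.partner p.1 < p.2) = #(π.nestings c) := by
    refine card_nbij' (fun p => (p.1, π.partner p.2)) (fun p => (p.1, π.partner p.2)) ?_ ?_
      (fun p _ => by simp) (fun p _ => by simp)
    all_goals
      rintro ⟨i, j⟩
      simp only [inversions, nestings, coe_filter, mem_filter, mem_univ, true_and,
        Set.mem_ofPred_eq, hpp, hc]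
      grind
  have e5 : #(((((π.inversions c).filter fun p => ¬ p.2 < π.partner p.2).filter
      fun p => p.1 < π.partner p.1).filter fun p => ¬ p.1 < π.partner p.2).filter
      fun p => π.partner p.1 < p.2) = #(π.nestings c) := by
    refine card_nbij' (fun p => (π.partner p.2, p.1)) (fun p => (p.2, π.partner p.1)) ?_ ?_
      (fun p _ => by simp) (fun p _ => by simp)
    all_goals
      rintro ⟨i, j⟩
      simp only [inversions, nestings, coe_filter, mem_filter, mem_univ, true_and,
        Set.mem_ofPred_eq, hpp, hc]
      grind
  have e6 : #(((((π.inversions c).filter fun p => ¬ p.2 < π.partner p.2).filter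
      fun p => p.1 < π.partner p.1).filter fun p => ¬ p.1 < π.partner p.2).filter
      fun p => ¬ π.partner p.1 < p.2) = #(π.crossings c) := by
    refine card_nbij' (fun p => (π.partner p.2, p.1)) (fun p => (p.2, π.partner p.1)) ?_ ?_
      (fun p _ => by simp) (fun p _ => by simp)
    all_goals
      rintro ⟨i, j⟩
      simp only [inversions, crossings, coe_filter, mem_filter, mem_univ, true_and,
        Set.mem_ofPred_eq, hpp, hc]
      grind
  omega

end Matching

/-! ### The sign of the surviving uncrossing -/

namespace NiceEmbedding

variable {n : ℕ} {π : Matching (Fin (2 * n))} {E : NiceEmbedding π}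

theorem IsCrossing.changes {c : E.Site} (hc : E.IsCrossing c) :
    ¬ (E.pos c.1.castSucc (E.upperStrand c) < E.pos c.1.castSucc (E.lowerStrand c) ↔
      E.pos c.1.succ (E.upperStrand c) < E.pos c.1.succ (E.lowerStrand c)) := by
  rw [Fin.lt_def, Fin.lt_def, hc.pos_upper, hc.pos_lower, pos_upperStrand, pos_lowerStrand]
  omega

theorem IsCrossing.upper_ne_lower {c : E.Site} (hc : E.IsCrossing c) :
    E.upperStrand c ≠ E.lowerStrand c := fun h => by
  have := hc.changes
  rw [h] at this
  simp at this

/-- Were the order at the left side different from that just before the crossing, the strands would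
already have crossed once. -/
theorem IsCrossing.upper_lt_lower {c : E.Site} (hc : E.IsCrossing c) :
    E.upperStrand c < E.lowerStrand c := by
  by_contra hlt
  obtain ⟨t, -, h2, h3⟩ := exists_change
    (fun t => E.pos t (E.upperStrand c) < E.pos t (E.lowerStrand c)) 0 c.1.castSucc
    (Fin.zero_le _) (by
      rw [E.pos_zero, E.pos_zero, Fin.lt_def (a := E.pos _ _), hc.pos_lower, pos_upperStrand]
      simp [hlt])
  rw [E.crossOnce _ _ _ _ h3 hc.changes] at h2
  exact absurd Fin.castSucc_lt_succ h2.not_gt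

theorem IsCrossing.partner_lower_lt {c : E.Site} (hc : E.IsCrossing c) :
    π.partner (E.lowerStrand c) < π.partner (E.upperStrand c) := by
  rcases lt_trichotomy (π.partner (E.lowerStrand c)) (π.partner (E.upperStrand c)) with h | h | h
  · exact h
  · exact absurd (π.partner_injective h).symm hc.upper_ne_lower
  · obtain ⟨t, h1, -, h3⟩ := exists_change
      (fun t => E.pos t (E.upperStrand c) < E.pos t (E.lowerStrand c)) c.1.succ (Fin.last _)
      (Fin.le_last _) (by
        rw [E.pos_last, E.pos_last, Fin.lt_def (a := E.pos _ _), hc.pos_upper, pos_lowerStrand]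
        simp [h])
    rw [E.crossOnce _ _ _ _ h3 hc.changes] at h1
    exact absurd Fin.castSucc_lt_succ h1.not_gt

theorem exists_crossing {i j : Fin (2 * n)} (hij : i < j) (hπ : π.partner j < π.partner i) :
    ∃ c : E.Site, E.IsCrossing c ∧ E.upperStrand c = i ∧ E.lowerStrand c = j := by
  by_contra hno
  have key : ∀ t, E.pos t i < E.pos t j := by
    intro t
    induction t using Fin.induction with
    | zero => rwa [E.pos_zero, E.pos_zero]
    | succ t ih =>
      by_contra hlt
      have hne : (E.pos t.succ i : ℕ) ≠ E.pos t.succ j := fun h =>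
        hij.ne ((E.pos t.succ).injective (Fin.ext h))
      have h1 := E.step t i
      have h2 := E.step t j
      rw [Fin.lt_def] at ih hlt
      refine hno ⟨(t, E.pos t.castSucc i), ?_, by simp [upperStrand], ?_⟩
      · simp only [IsCrossing, upperStrand, Equiv.symm_apply_apply]
        omega
      · simp only [lowerStrand]
        rw [Equiv.symm_apply_eq]
        exact Fin.ext (by omega)
  have := key (Fin.last _)
  rw [E.pos_last, E.pos_last] at this
  exact absurd hπ this.not_gt

/-- The paired crossings between edges of the same orientation are the inversions of `π` between
edges of the same colour. -/
theorem card_paired_notMem_strandUncrossing {I : Finset (Fin (2 * n))} :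
    #{c : E.Site | E.IsPaired c ∧ c ∉ E.strandUncrossing I} = #(π.inversions (· ∈ I)) := by
  refine card_bij (fun c _ => (E.upperStrand c, E.lowerStrand c)) ?_ ?_ ?_
  · intro c hc
    simp only [mem_filter, mem_univ, true_and, IsPaired, isUnpaired_iff, strandUncrossing] at hc
    obtain ⟨⟨hc, h1⟩, h2⟩ := hc
    simp only [Matching.inversions, mem_filter, mem_univ, true_and]
    exact ⟨hc.upper_lt_lower, hc.partner_lower_lt, fun h => h1 ⟨hc, h.symm⟩,
      by_contra fun h => h2 ⟨hc, h⟩⟩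
  · intro c hc d hd h
    replace hc := (mem_filter.1 hc).2
    replace hd := (mem_filter.1 hd).2
    rw [Prod.mk.injEq] at h
    have h1 := hc.1.1.changes
    have h2 := hd.1.1.changes
    rw [h.1, h.2] at h1
    have h3 := E.crossOnce _ _ _ _ h1 h2
    have h4 := E.pos_upperStrand c
    rw [h.1, h3, pos_upperStrand] at h4
    exact Prod.ext h3 h4.symm
  · rintro ⟨i, j⟩ hij
    simp only [Matching.inversions, mem_filter, mem_univ, true_and] at hij
    obtain ⟨c, hc, rfl, rfl⟩ := exists_crossing (E := E) hij.1 hij.2.1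
    refine ⟨c, ?_, rfl⟩
    simp only [mem_filter, mem_univ, true_and, IsPaired, isUnpaired_iff, strandUncrossing]
    exact ⟨⟨hc, fun h => hij.2.2.1 h.2.symm⟩, fun h => h.2 hij.2.2.2⟩

/-- An unpaired crossing is between `i` and `π(i)`, of equal colour, so none is vertical. The
horizontal paired crossings are twice `ph` in number, hence `ph` is the number of crossings plus
twice that of nestings. -/
theorem sign_strandUncrossing {I : Finset (Fin (2 * n))} (hI : ∀ i, π.partner i ∈ I ↔ i ∈ I) :
    E.sign (E.strandUncrossing I) = (-1) ^ #(π.crossings (· ∈ I)) := by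
  have hx := strandUncrossing_mem (E := E) hI
  have huv : E.unpairedVertical (E.strandUncrossing I) = 0 := by
    rw [unpairedVertical, card_eq_zero, eq_empty_iff_forall_notMem]
    intro c hc
    simp only [mem_filter, mem_univ, true_and, isUnpaired_iff, strandUncrossing] at hc
    obtain ⟨⟨-, h1⟩, -, h2⟩ := hc
    rw [← h1, hI] at h2
    exact h2 Iff.rfl
  have hp : ∀ c, E.IsPaired (E.siteMirror c) ↔ E.IsPaired c := fun c => by
    rw [IsPaired, IsPaired, isCrossing_siteMirror, isUnpaired_siteMirror]
  have hph : #{c : E.Site | E.IsPaired c ∧ c ∉ E.strandUncrossing I} =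
      2 * E.pairedHorizontal (E.strandUncrossing I) := by
    rw [← card_filter_add_card_filter_not (fun c : E.Site => c.1 < c.1.rev),
      two_mul (E.pairedHorizontal _),
      filter_filter, filter_filter]
    simp only [and_assoc]
    congr 1
    rw [pairedHorizontal]
    refine card_nbij' E.siteMirror E.siteMirror ?_ ?_ (fun c _ => siteMirror_siteMirror c)
      (fun c _ => siteMirror_siteMirror c)
    · intro c hc
      simp only [coe_filter, mem_univ, true_and, Set.mem_ofPred_eq] at hc ⊢
      refine ⟨(hp c).2 hc.1, fun h => hc.2.1 ((siteMirror_mem_iff hx).1 h), ?_⟩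
      simp only [siteMirror, Fin.rev_rev]
      refine lt_of_le_of_ne (not_lt.1 hc.2.2) fun h => ?_
      exact hc.1.2 (hc.1.1.axis h.symm)
    · intro c hc
      simp only [coe_filter, mem_univ, true_and, Set.mem_ofPred_eq] at hc ⊢
      refine ⟨(hp c).2 hc.1, fun h => hc.2.1 ((siteMirror_mem_iff hx).1 h), ?_⟩
      simp only [siteMirror, Fin.rev_rev]
      exact hc.2.2.not_gt
  rw [card_paired_notMem_strandUncrossing, π.card_inversions (· ∈ I) hI] at hph
  rw [sign, huv, zero_add, show E.pairedHorizontal (E.strandUncrossing I) =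
    #(π.crossings (· ∈ I)) + 2 * #(π.nestings (· ∈ I)) by omega, pow_add, pow_mul]
  simp

end NiceEmbedding

/-! ### Products of complementary pfaffians -/

namespace Matching

variable {α : Type*}

/-- The restriction of a matching to a union of its edges. -/
def restrict (π : Matching α) (J : Finset α) (h : ∀ i, π.partner i ∈ J ↔ i ∈ J) : Matching J :=
  ofInvolutive (fun i => ⟨π.partner i, (h i).2 i.2⟩) (fun i => Subtype.ext (π.partner_partner i))
    fun i hi => π.partner_ne i (congrArg Subtype.val hi)

@[simp] theorem coe_partner_restrict (π : Matching α) (J : Finset α)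
    (h : ∀ i, π.partner i ∈ J ↔ i ∈ J) (i : J) :
    ((π.restrict J h).partner i : α) = π.partner i := rfl

variable [Fintype α] [LinearOrder α]

theorem crossingNumber_restrict (π : Matching α) (J : Finset α)
    (h : ∀ i, π.partner i ∈ J ↔ i ∈ J) :
    (π.restrict J h).crossingNumber = #{p ∈ π.crossings (· ∈ J) | p.1 ∈ J} := by
  rw [crossingNumber]
  refine card_bij (fun p _ => ((p.1 : α), (p.2 : α))) ?_ ?_ ?_
  · rintro ⟨i, j⟩ hp
    simp only [mem_filter, mem_univ, true_and, crossings, ← Subtype.coe_lt_coe,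
      coe_partner_restrict] at hp ⊢
    simpa [i.2, j.2] using hp
  · rintro ⟨i, j⟩ - ⟨i', j'⟩ - hp
    simp only [Prod.mk.injEq] at hp
    exact Prod.ext (Subtype.ext hp.1) (Subtype.ext hp.2)
  · rintro ⟨i, j⟩ hp
    simp only [mem_filter, mem_univ, true_and, crossings] at hp
    obtain ⟨⟨h1, h2, h3, h4⟩, h5⟩ := hp
    refine ⟨(⟨i, h5⟩, ⟨j, h4.1 h5⟩), ?_, rfl⟩
    simp only [mem_filter, mem_univ, true_and, ← Subtype.coe_lt_coe, coe_partner_restrict]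
    exact ⟨h1, h2, h3⟩

theorem monomial_restrict {R : Type*} [CommRing R] (A : Matrix α α R) (π : Matching α)
    (J : Finset α) (h : ∀ i, π.partner i ∈ J ↔ i ∈ J) :
    (π.restrict J h).monomial (A.submatrix (Subtype.val : J → α) (Subtype.val : J → α)) =
      ∏ i : α with i < π.partner i ∧ i ∈ J, A i (π.partner i) := by
  rw [monomial]
  refine prod_bij (fun i _ => (i : α)) ?_ ?_ ?_ ?_
  · intro i hi
    simp only [mem_filter, mem_univ, true_and, ← Subtype.coe_lt_coe, coe_partner_restrict] at hi ⊢
    exact ⟨hi, i.2⟩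
  · intro i _ j _ hij
    exact Subtype.ext hij
  · intro i hi
    simp only [mem_filter, mem_univ, true_and] at hi
    refine ⟨⟨i, hi.2⟩, ?_, rfl⟩
    simp only [mem_filter, mem_univ, true_and, ← Subtype.coe_lt_coe, coe_partner_restrict]
    exact hi.1
  · intro i _
    rfl

/-- The union of matchings of a set and its complement. -/
theorem exists_restrict_eq (I : Finset α) (ρ : Matching I) (σ : Matching (Iᶜ : Finset α)) :
    ∃ (π : Matching α) (h : ∀ i, π.partner i ∈ I ↔ i ∈ I)
      (h' : ∀ i, π.partner i ∈ Iᶜ ↔ i ∈ Iᶜ), π.restrict I h = ρ ∧ π.restrict Iᶜ h' = σ := by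
  let f : α → α := fun i => if h : i ∈ I then ρ.partner ⟨i, h⟩ else σ.partner ⟨i, mem_compl.2 h⟩
  have f1 : ∀ i (h : i ∈ I), f i = ρ.partner ⟨i, h⟩ := fun i h => dif_pos h
  have f2 : ∀ i (h : i ∉ I), f i = σ.partner ⟨i, mem_compl.2 h⟩ := fun i h => dif_neg h
  have hf : ∀ i, f i ∈ I ↔ i ∈ I := fun i => by
    by_cases h : i ∈ I
    · rw [f1 i h]; simp [h]
    · rw [f2 i h]
      exact iff_of_false (mem_compl.1 (σ.partner _).2) h
  have hinv : Function.Involutive f := fun i => by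
    by_cases h : i ∈ I
    · rw [f1 _ ((hf i).2 h)]
      have : (⟨f i, (hf i).2 h⟩ : I) = ρ.partner ⟨i, h⟩ := Subtype.ext (f1 i h)
      rw [this, partner_partner]
    · have h' := mt (hf i).1 h
      rw [f2 _ h']
      have : (⟨f i, mem_compl.2 h'⟩ : (Iᶜ : Finset α)) = σ.partner ⟨i, mem_compl.2 h⟩ :=
        Subtype.ext (f2 i h)
      rw [this, partner_partner]
  have hne : ∀ i, f i ≠ i := fun i hi => by
    by_cases h : i ∈ I
    · rw [f1 i h] at hi
      exact ρ.partner_ne _ (Subtype.ext hi)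
    · rw [f2 i h] at hi
      exact σ.partner_ne _ (Subtype.ext hi)
  refine ⟨ofInvolutive f hinv hne, hf, fun i => ?_, ?_, ?_⟩
  · rw [mem_compl, mem_compl]
    exact not_congr (hf i)
  · exact ext_partner fun i => Subtype.ext (f1 i i.2)
  · exact ext_partner fun i => Subtype.ext (f2 i (mem_compl.1 i.2))

end Matching

/-- The product of two complementary pfaffians as a sum over matchings. -/
theorem subPfaffian_mul_subPfaffian_compl {α : Type*} [Fintype α] [LinearOrder α] {R : Type*}
    [CommRing R] (A : Matrix α α R) (I : Finset α) :
    subPfaffian I A * subPfaffian Iᶜ A =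
      ∑ π : Matching α with ∀ i, π.partner i ∈ I ↔ i ∈ I,
        (-1) ^ #(π.crossings (· ∈ I)) * π.monomial A := by
  have hcompl : ∀ π : Matching α, (∀ i, π.partner i ∈ I ↔ i ∈ I) →
      ∀ i, π.partner i ∈ Iᶜ ↔ i ∈ Iᶜ := fun π h i => by
    rw [mem_compl, mem_compl, h]
  rw [subPfaffian, subPfaffian, pfaffian, pfaffian, sum_mul_sum, ← sum_product']
  symm
  refine sum_bij (fun π h => (π.restrict I (mem_filter.1 h).2,
    π.restrict Iᶜ (hcompl π (mem_filter.1 h).2))) ?_ ?_ ?_ ?_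
  · intro π _
    exact mem_product.2 ⟨mem_univ _, mem_univ _⟩
  · intro π hπ ρ hρ h
    rw [Prod.mk.injEq] at h
    refine Matching.ext_partner fun i => ?_
    by_cases hi : i ∈ I
    · have := congrArg (fun m : Matching I => (m.partner ⟨i, hi⟩ : α)) h.1
      exact this
    · have := congrArg (fun m : Matching (Iᶜ : Finset α) =>
        (m.partner ⟨i, mem_compl.2 hi⟩ : α)) h.2
      exact this
  · rintro ⟨ρ, σ⟩ -
    obtain ⟨π, h, h', rfl, rfl⟩ := Matching.exists_restrict_eq I ρ σ
    exact ⟨π, mem_filter.2 ⟨mem_univ _, h⟩, rfl⟩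
  · intro π hπ
    rw [Matching.crossingNumber_restrict, Matching.crossingNumber_restrict,
      Matching.monomial_restrict, Matching.monomial_restrict]
    have h1 : π.monomial A = (∏ i : α with i < π.partner i ∧ i ∈ I, A i (π.partner i)) *
        ∏ i : α with i < π.partner i ∧ i ∈ Iᶜ, A i (π.partner i) := by
      rw [Matching.monomial, ← prod_filter_mul_prod_filter_not _ (· ∈ I), filter_filter,
        filter_filter]
      simp only [mem_compl]
    have h2 : π.crossings (· ∈ Iᶜ) = π.crossings (· ∈ I) := by
      simp only [Matching.crossings, mem_compl, not_iff_not]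
    have h3 : #(π.crossings (· ∈ I)) = #{p ∈ π.crossings (· ∈ I) | p.1 ∈ I} +
        #{p ∈ π.crossings (· ∈ Iᶜ) | p.1 ∈ Iᶜ} := by
      rw [← card_filter_add_card_filter_not (fun p : α × α => p.1 ∈ I), h2]
      simp only [mem_compl]
    rw [h1, h3, pow_add]
    ring

/-! ### Erasure, completion and maximal diagrams -/

namespace SymDiagram

variable {n : ℕ}

/-! ### The left half of a symmetric diagram -/

/-- The left end of the edge at the left point `i` other than `i`, or `i` if the edge goes to the
right side. -/
def arc (D : SymDiagram n) (i : Fin (2 * n)) : Fin (2 * n) :=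
  match D.partner (Sum.inl i) with
  | Sum.inl j => j
  | Sum.inr _ => i

variable (D : SymDiagram n)

theorem partner_swap (v : Vertex n) : D.partner v.swap = (D.partner v).swap := D.symmetric v

/-- An edge from `i` to `j'` would cross its mirror image, from `j` to `i'`, if `i ≠ j`. -/
theorem eq_of_partner_inl {i j : Fin (2 * n)} (h : D.partner (Sum.inl i) = Sum.inr j) :
    j = i := by
  have h1 : D.partner (Sum.inl j) = Sum.inr i := by
    have := D.partner_swap (Sum.inr j)
    have h0 : D.partner (Sum.inr j) = Sum.inl i := by rw [← h, partner_partner]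
    rw [h0] at this
    exact this
  have h2 := D.noncrossing (Sum.inl i) (Sum.inl j)
  have h3 := D.noncrossing (Sum.inl j) (Sum.inl i)
  change ¬ (_ ∧ _ < (D.partner _).rank ∧ (D.partner _).rank < (D.partner _).rank) at h2
  change ¬ (_ ∧ _ < (D.partner _).rank ∧ (D.partner _).rank < (D.partner _).rank) at h3
  rw [h, h1] at h2 h3
  simp only [Vertex.rank] at h2 h3
  ext
  omega

theorem partner_inl (i : Fin (2 * n)) :
    D.partner (Sum.inl i) = if D.arc i = i then Sum.inr i else Sum.inl (D.arc i) := by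
  rcases h : D.partner (Sum.inl i) with j | j
  · have h1 : D.arc i = j := by rw [arc, h]
    have h2 : j ≠ i := fun hji => D.partner_ne (Sum.inl i) (by rw [h, hji])
    rw [h1, if_neg h2]
  · have h1 : D.arc i = i := by rw [arc, h]
    rw [if_pos h1, D.eq_of_partner_inl h]

theorem partner_inr (i : Fin (2 * n)) :
    D.partner (Sum.inr i) = if D.arc i = i then Sum.inl i else Sum.inr (D.arc i) := by
  have := D.partner_swap (Sum.inl i)
  rw [Sum.swap_inl, partner_inl] at this
  rw [this]
  split_ifs <;> rfl

theorem ext_arc {D D' : SymDiagram n} (h : ∀ i, D.arc i = D'.arc i) : D = D' := by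
  refine SymDiagram.ext (Matching.ext_partner ?_)
  rintro (i | i)
  · change D.partner _ = D'.partner _
    rw [partner_inl, partner_inl, h]
  · change D.partner _ = D'.partner _
    rw [partner_inr, partner_inr, h]

@[simp] theorem arc_arc (i : Fin (2 * n)) : D.arc (D.arc i) = i := by
  by_cases h : D.arc i = i
  · rw [h, h]
  · have h1 := D.partner_inl i
    rw [if_neg h] at h1
    have h2 := D.partner_partner (Sum.inl i)
    rw [h1, partner_inl] at h2
    split_ifs at h2 with h3
    exact Sum.inl_injective h2

theorem arc_nested {i j : Fin (2 * n)} (h1 : i < j) (h2 : j < D.arc i) :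
    D.arc j ≠ j ∧ i < D.arc j ∧ D.arc j < D.arc i := by
  have h3 := D.noncrossing (Sum.inl i) (Sum.inl j)
  have h4 := D.noncrossing (Sum.inl (D.arc j)) (Sum.inl i)
  change ¬ (_ ∧ _ < (D.partner _).rank ∧ (D.partner _).rank < (D.partner _).rank) at h3
  change ¬ (_ ∧ _ < (D.partner _).rank ∧ (D.partner _).rank < (D.partner _).rank) at h4
  have hi : D.arc i ≠ i := (h1.trans h2).ne'
  have h5 : D.arc j ≠ i := fun h => by rw [← h, arc_arc] at h2; exact h2.false
  have h6 : D.arc j ≠ D.arc i := fun h => by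
    have := congrArg D.arc h
    rw [arc_arc, arc_arc] at this
    exact h1.ne' this
  rw [D.partner_inl i, if_neg hi] at h3 h4
  rw [D.partner_inl, arc_arc] at h4
  rw [D.partner_inl] at h3
  by_cases hj : D.arc j = j
  · rw [if_pos hj] at h3
    simp only [Vertex.rank] at h3
    omega
  · rw [if_neg hj] at h3
    rw [if_neg fun h => hj h.symm] at h4
    simp only [Vertex.rank] at h3 h4
    omega

/-- The symmetric map on the boundary points with a given left half, fixed points of which stand
for the edges to the right side. -/
def symmetrize (q : Fin (2 * n) → Fin (2 * n)) : Vertex n → Vertex n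
  | Sum.inl i => if q i = i then Sum.inr i else Sum.inl (q i)
  | Sum.inr i => if q i = i then Sum.inl i else Sum.inr (q i)

theorem symmetrize_involutive {q : Fin (2 * n) → Fin (2 * n)} (hq : Function.Involutive q) :
    Function.Involutive (symmetrize q) := by
  have h : ∀ i, q (q i) = i := fun i => hq i
  rintro (i | i)
  all_goals
    have hi' : i = q i ↔ q i = i := eq_comm
    by_cases hi : q i = i <;> simp [symmetrize, hi, h, hi']

theorem symmetrize_ne (q : Fin (2 * n) → Fin (2 * n)) (v : Vertex n) : symmetrize q v ≠ v := by
  rcases v with i | i <;> by_cases hi : q i = i <;> simp [symmetrize, hi]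

theorem symmetrize_swap (q : Fin (2 * n) → Fin (2 * n)) (v : Vertex n) :
    symmetrize q v.swap = (symmetrize q v).swap := by
  rcases v with i | i <;> simp only [Sum.swap_inl, Sum.swap_inr, symmetrize] <;> split_ifs <;> rfl

theorem symmetrize_noncrossing {q : Fin (2 * n) → Fin (2 * n)} (hq : Function.Involutive q)
    (hnest : ∀ i j, i < j → j < q i → q j ≠ j ∧ i < q j ∧ q j < q i) (u v : Vertex n) :
    ¬ (u.rank < v.rank ∧ v.rank < (symmetrize q u).rank ∧
      (symmetrize q u).rank < (symmetrize q v).rank) := by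
  have h : ∀ i, q (q i) = i := fun i => hq i
  rintro ⟨h1, h2, h3⟩
  rcases u with i | i <;> rcases v with j | j <;> by_cases hi : q i = i <;>
    by_cases hj : q j = j <;>
    simp only [symmetrize, hi, hj, if_true, if_false, Vertex.rank] at h1 h2 h3 <;> try omega
  · exact (hnest i j h1 h2).1 hj
  · have := hnest i j h1 h2
    omega
  · have := hnest (q j) i
    rw [h] at this
    omega
  · have := hnest (q i) j
    rw [h] at this
    omega

/-- The symmetric diagram with a given left half. -/
def ofArc (q : Fin (2 * n) → Fin (2 * n)) (hq : Function.Involutive q)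
    (hnest : ∀ i j, i < j → j < q i → q j ≠ j ∧ i < q j ∧ q j < q i) : SymDiagram n where
  matching := Matching.ofInvolutive (symmetrize q) (symmetrize_involutive hq) (symmetrize_ne q)
  noncrossing := symmetrize_noncrossing hq hnest
  symmetric := symmetrize_swap q

@[simp] theorem arc_ofArc (q : Fin (2 * n) → Fin (2 * n)) (hq : Function.Involutive q)
    (hnest : ∀ i j, i < j → j < q i → q j ≠ j ∧ i < q j ∧ q j < q i) (i : Fin (2 * n)) :
    (ofArc q hq hnest).arc i = q i := by
  have h : (ofArc q hq hnest).partner (Sum.inl i) =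
    if q i = i then Sum.inr i else Sum.inl (q i) := rfl
  rw [arc, h]
  by_cases hi : q i = i <;> simp [hi]

/-! ### Order, compatibility and erasure in terms of arcs -/

theorem order_eq : D.order = #{i : Fin (2 * n) | i < D.arc i} := by
  rw [order]
  refine card_bij (fun e _ => e.1) ?_ ?_ ?_
  · rintro ⟨i, j⟩ he
    simp only [mem_filter, mem_univ, true_and, partner_inl] at he ⊢
    obtain ⟨h1, h2⟩ := he
    split_ifs at h2 with h
    rwa [Sum.inl_injective h2]
  · rintro ⟨i, j⟩ he ⟨i', j'⟩ he' (rfl : i = i')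
    simp only [mem_filter, mem_univ, true_and] at he he'
    rw [he.2] at he'
    rw [Sum.inl_injective he'.2]
  · intro i hi
    simp only [mem_filter, mem_univ, true_and] at hi
    refine ⟨(i, D.arc i), ?_, rfl⟩
    simp only [mem_filter, mem_univ, true_and]
    exact ⟨hi, by rw [partner_inl, if_neg hi.ne']⟩

variable {D} in
-- The ends `i`, `i'` of a through edge always have different colours, so only edges within a side
-- matter; erasing edges therefore preserves compatibility.
theorem compatible_iff {I : Finset (Fin (2 * n))} :
    D.Compatible I ↔ ∀ i, D.arc i ≠ i → (i ∈ I ↔ D.arc i ∉ I) := by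
  constructor
  · intro h i hi
    have := h (Sum.inl i)
    rwa [partner_inl, if_neg hi] at this
  · rintro h (i | i)
    · rw [partner_inl]
      split_ifs with hi
      · simp [IsBlack]
      · exact h i hi
    · rw [partner_inr]
      split_ifs with hi
      · simp [IsBlack]
      · have := h i hi
        simp only [IsBlack]
        tauto

variable {D} in
theorem mem_S_iff {D' : SymDiagram n} : D' ∈ D.S ↔ ∀ i, D'.arc i = D.arc i ∨
    (D'.arc i = i ∧ Even (min i (D.arc i) : Fin (2 * n)).val) := by
  rw [S, mem_filter, and_iff_right (mem_univ _)]
  refine forall_congr' fun i => ?_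
  rw [partner_inl, partner_inl]
  by_cases h' : D'.arc i = i <;> by_cases h : D.arc i = i
  · simp [h, h']
  · simpa [h, h'] using fun e => absurd (Eq.symm e) h
  · simp [h, h']
  · simp [h, h']

theorem mem_S_self : D ∈ D.S := mem_S_iff.2 fun _ => Or.inl rfl

variable {D} {D' D'' : SymDiagram n}

/-- With `mem_S_self` and `mem_S_antisymm`, this makes `D ∈ D'.S` a partial order, in which
completions of a diagram lie above it. -/
theorem mem_S_trans (h : D ∈ D'.S) (h' : D' ∈ D''.S) : D ∈ D''.S := by
  rw [mem_S_iff] at *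
  intro i
  rcases h i with h1 | ⟨h1, h2⟩
  · rw [h1]; exact h' i
  · rcases h' i with h3 | ⟨h3, h4⟩
    · rw [h3] at h2; exact Or.inr ⟨h1, h2⟩
    · exact Or.inr ⟨h1, h4⟩

theorem mem_S_antisymm (h : D ∈ D'.S) (h' : D' ∈ D.S) : D = D' := by
  rw [mem_S_iff] at *
  refine ext_arc fun i => ?_
  rcases h i with h1 | ⟨h1, -⟩
  · exact h1
  · rcases h' i with h3 | ⟨h3, -⟩
    · exact h3.symm
    · rw [h1, h3]

theorem Compatible.of_mem_S {I : Finset (Fin (2 * n))} (hD : D.Compatible I) (h : D' ∈ D.S) :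
    D'.Compatible I := by
  rw [compatible_iff] at *
  rw [mem_S_iff] at h
  intro i hi
  rcases h i with h1 | ⟨h1, -⟩
  · rw [h1] at hi ⊢; exact hD i hi
  · exact absurd h1 hi

theorem even_of_mem_S (h : D' ∈ D.S) {i : Fin (2 * n)} (h' : D'.arc i = i) (hi : D.arc i ≠ i) :
    Even (min i (D.arc i) : Fin (2 * n)).val ∧ D'.arc (D.arc i) = D.arc i := by
  rw [mem_S_iff] at h
  constructor
  · rcases h i with h1 | h1
    · exact absurd (h1.symm.trans h') hi
    · exact h1.2
  · rcases h (D.arc i) with h1 | h1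
    · rw [arc_arc] at h1
      have := congrArg D'.arc h1
      rw [arc_arc, h'] at this
      exact absurd this hi
    · exact h1.1

/-! ### Parity -/

/-- An interval which is a union of arcs has even length. -/
theorem even_of_interval (D : SymDiagram n) {a b : ℕ} (hb : b ≤ 2 * n)
    (h : ∀ k : Fin (2 * n), a ≤ k → (k : ℕ) < b → D.arc k ≠ k ∧ a ≤ D.arc k ∧ (D.arc k : ℕ) < b) :
    Even (b - a) := by
  have h1 : Even #{k : Fin (2 * n) | a ≤ k ∧ (k : ℕ) < b} := by
    refine even_card_of_involution _ D.arc ?_ (fun k _ => D.arc_arc k) ?_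
    · intro k hk
      simp only [mem_filter, mem_univ, true_and] at hk ⊢
      exact (h k hk.1 hk.2).2
    · intro k hk
      simp only [mem_filter, mem_univ, true_and] at hk
      exact (h k hk.1 hk.2).1
  have h2 : ({k : Fin (2 * n) | a ≤ k ∧ (k : ℕ) < b} : Finset (Fin (2 * n))).image Fin.val =
      Ico a b := by
    ext k
    simp only [mem_image, mem_filter, mem_univ, true_and, mem_Ico]
    constructor
    · rintro ⟨k, hk, rfl⟩; exact hk
    · intro hk; exact ⟨⟨k, by omega⟩, hk, rfl⟩
  rw [← Nat.card_Ico, ← h2, card_image_of_injective _ Fin.val_injective]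
  exact h1

theorem arc_lt_of_fixed (D : SymDiagram n) {k j : Fin (2 * n)} (hk : k < j) (hj : D.arc j = j) :
    D.arc k < j := by
  rcases lt_trichotomy (D.arc k) j with h | h | h
  · exact h
  · rw [← h, arc_arc] at hj
    exact absurd (hj.trans h) hk.ne
  · exact absurd hj (D.arc_nested hk h).1

theorem lt_arc_of_fixed (D : SymDiagram n) {k i : Fin (2 * n)} (hk : i < k) (hi : D.arc i = i) :
    i < D.arc k := by
  rcases lt_trichotomy (D.arc k) i with h | h | h
  · exact absurd hi (D.arc_nested h (by rwa [arc_arc])).1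
  · rw [← h, arc_arc] at hi
    exact absurd (hi.trans h) hk.ne'
  · exact h

/-- Consecutive through points have different parities. -/
theorem even_between (D : SymDiagram n) {i j : Fin (2 * n)} (hi : D.arc i = i)
    (hj : D.arc j = j) (h : ∀ k, i < k → k < j → D.arc k ≠ k) : Even ((j : ℕ) - (i + 1)) := by
  refine D.even_of_interval j.2.le fun k h1 h2 => ?_
  have h1 : i < k := h1
  exact ⟨h k h1 h2, D.lt_arc_of_fixed h1 hi, D.arc_lt_of_fixed h2 hj⟩

/-- The points that an erasure sets free are consecutive through points. -/
theorem not_fixed_between (h : D' ∈ D.S) {i : Fin (2 * n)} (hi : D'.arc i = i)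
    (hlt : i < D.arc i) : ∀ k, i < k → k < D.arc i → D'.arc k ≠ k := by
  by_contra hex
  push Not at hex
  obtain ⟨k, hk, hmin⟩ := exists_min_image
    (univ.filter fun k => i < k ∧ k < D.arc i ∧ D'.arc k = k) id (by
      obtain ⟨k, hk⟩ := hex
      exact ⟨k, by simpa using hk⟩)
  simp only [mem_filter, mem_univ, true_and, id] at hk hmin
  obtain ⟨h1, h2, h3⟩ := hk
  have hev := (even_of_mem_S h hi hlt.ne').1
  rw [min_eq_left hlt.le] at hev
  have hodd := D'.even_between hi h3 fun l hl1 hl2 hl3 =>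
    absurd (hmin l ⟨hl1, hl2.trans h2, hl3⟩) hl2.not_ge
  -- The first freed point `k` under the arc has odd value by `even_between`; by minimality it is
  -- also the upper end of an erased edge, so its value is even.
  have hn := D.arc_nested h1 h2
  have hk := even_of_mem_S h h3 hn.1
  have h4 := hmin (D.arc k) ⟨hn.2.1, hn.2.2, hk.2⟩
  rw [min_eq_left h4, Nat.even_iff] at hk
  rw [Nat.even_iff] at hodd hev
  omega

/-- Consecutive through points, the upper of them odd, remain so or get joined when `D'` is
completed to `D`. -/
theorem arc_of_consecutive (h : D' ∈ D.S) {i j : Fin (2 * n)} (hij : i < j) (hi : D'.arc i = i)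
    (hj : D'.arc j = j) (hbet : ∀ k, i < k → k < j → D'.arc k ≠ k) (hev : Even (i : ℕ)) :
    D.arc i = j ∨ (D.arc i = i ∧ D.arc j = j) := by
  have hodd := D'.even_between hi hj hbet
  rw [Nat.even_iff] at hodd hev
  by_cases h1 : D.arc i = i
  · refine or_iff_not_imp_left.2 fun hne => ⟨h1, ?_⟩
    by_contra h2
    obtain ⟨h3, h4⟩ := even_of_mem_S h hj h2
    rw [Nat.even_iff] at h3
    rcases lt_or_gt_of_ne h2 with hlt | hgt
    · have h5 := not_fixed_between h h4 (by rwa [arc_arc])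
      rw [arc_arc] at h5
      rcases lt_trichotomy (D.arc j) i with h6 | h6 | h6
      · exact h5 i h6 hij hi
      · rw [← h6, arc_arc] at hne
        exact hne rfl
      · exact hbet _ h6 hlt h4
    · rw [min_eq_left hgt.le] at h3
      omega
  · left
    obtain ⟨h3, h4⟩ := even_of_mem_S h hi h1
    rw [Nat.even_iff] at h3
    rcases lt_or_gt_of_ne h1 with hlt | hgt
    · have h5 := not_fixed_between h h4 (by rwa [arc_arc])
      rw [arc_arc] at h5
      have h6 := D'.even_between h4 hi h5
      rw [min_eq_right hlt.le] at h3
      rw [Nat.even_iff] at h6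
      omega
    · have h5 := not_fixed_between h hi hgt
      rcases lt_trichotomy (D.arc i) j with h6 | h6 | h6
      · exact absurd h4 (hbet _ hgt h6)
      · exact h6
      · exact absurd hj (h5 j hij h6)

/-! ### Joining consecutive through points -/

/-- No arc passes over a through point, so the new arc crosses none; consecutiveness ensures that it
covers no through point. -/
theorem exists_join (D : SymDiagram n) {i j : Fin (2 * n)} (hij : i < j) (hi : D.arc i = i)
    (hj : D.arc j = j) (hbet : ∀ k, i < k → k < j → D.arc k ≠ k) :
    ∃ D' : SymDiagram n, ∀ k, D'.arc k = if k = i then j else if k = j then i else D.arc k := by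
  have hinv := D.arc_arc
  have hn : ∀ i j, i < j → j < D.arc i → D.arc j ≠ j ∧ i < D.arc j ∧ D.arc j < D.arc i :=
    fun i j => D.arc_nested
  have ha := fun k (h : k < j) => D.arc_lt_of_fixed h hj
  have hb := fun k (h : i < k) => D.lt_arc_of_fixed h hi
  refine ⟨ofArc (fun k => if k = i then j else if k = j then i else D.arc k) ?_ ?_,
    fun k => arc_ofArc _ _ _ k⟩
  · intro k
    grind
  · intro a b h1 h2
    grind

/-- The number of points that are not through points. -/
def size (D : SymDiagram n) : ℕ := #{k : Fin (2 * n) | D.arc k ≠ k}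

theorem exists_larger (D : SymDiagram n) {i j : Fin (2 * n)} (hij : i < j) (hi : D.arc i = i)
    (hj : D.arc j = j) (hbet : ∀ k, i < k → k < j → D.arc k ≠ k) (hev : Even (i : ℕ)) :
    ∃ D' : SymDiagram n, D ∈ D'.S ∧ D.size < D'.size ∧
      ∀ I, D.Compatible I → (i ∈ I ↔ j ∉ I) → D'.Compatible I := by
  obtain ⟨D', hD'⟩ := D.exists_join hij hi hj hbet
  refine ⟨D', mem_S_iff.2 fun k => ?_, card_lt_card ?_,
    fun I hI hc => compatible_iff.2 fun k hk => ?_⟩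
  · rw [hD']
    split_ifs with h1 h2
    · subst h1
      exact Or.inr ⟨hi, by rwa [min_eq_left hij.le]⟩
    · subst h2
      exact Or.inr ⟨hj, by rwa [min_eq_right hij.le]⟩
    · exact Or.inl rfl
  · rw [ssubset_iff_of_subset]
    · refine ⟨i, ?_, ?_⟩
      · simp only [mem_filter, mem_univ, true_and, hD', if_true]
        exact hij.ne'
      · simp [hi]
    · intro k hk
      simp only [mem_filter, mem_univ, true_and, hD'] at hk ⊢
      split_ifs with h1 h2
      · rw [h1]; exact hij.ne'
      · rw [h2]; exact hij.ne
      · exact hk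
  · rw [compatible_iff] at hI
    have := hI k
    rw [hD'] at hk ⊢
    split_ifs at hk ⊢ with h1 h2
    · rw [h1]; exact hc
    · rw [h2]; tauto
    · exact this hk

/-- Every `I`-compatible diagram has a greatest `I`-compatible completion, and this is even. -/
theorem exists_greatest {I : Finset (Fin (2 * n))} (hD : D.Compatible I) :
    ∃ T : SymDiagram n, T.Compatible I ∧ D ∈ T.S ∧
      (∀ D' : SymDiagram n, D'.Compatible I → D ∈ D'.S → D' ∈ T.S) ∧
      ∀ i j, i < j → T.arc i = i → T.arc j = j → (∀ k, i < k → k < j → T.arc k ≠ k) →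
        Even (i : ℕ) → (i ∈ I ↔ j ∈ I) := by
  obtain ⟨T, hT, hmax⟩ := exists_max_image
    (univ.filter fun T : SymDiagram n => T.Compatible I ∧ D ∈ T.S) size
    ⟨D, by simpa using ⟨hD, D.mem_S_self⟩⟩
  simp only [mem_filter, mem_univ, true_and] at hT hmax
  have hjoin : ∀ i j, i < j → T.arc i = i → T.arc j = j → (∀ k, i < k → k < j → T.arc k ≠ k) →
      Even (i : ℕ) → (i ∈ I ↔ j ∈ I) := by
    intro i j hij hi hj hbet hev
    by_contra hc
    obtain ⟨T', h1, h2, h3⟩ := T.exists_larger hij hi hj hbet hev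
    exact absurd (hmax T' ⟨h3 I hT.1 (by tauto), mem_S_trans hT.2 h1⟩) h2.not_ge
  refine ⟨T, hT.1, hT.2, fun D' hD' hDD' => ?_, hjoin⟩
  -- An edge of `D'` absent from `D` joins consecutive through points of `D`. If `T` left them
  -- unjoined, `hjoin` would give them equal colours, against the compatibility of `D'`.
  have key : ∀ i, i < D'.arc i → D'.arc i = T.arc i := by
    intro i hlt
    by_cases hi : D.arc i = i
    · obtain ⟨hev, hj⟩ := even_of_mem_S hDD' hi hlt.ne'
      rw [min_eq_left hlt.le] at hev
      have hbet := not_fixed_between hDD' hi hlt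
      rcases arc_of_consecutive hT.2 hlt hi hj hbet hev with h | ⟨h1, h2⟩
      · exact h.symm
      · have hc := hjoin i _ hlt h1 h2 (fun k hk1 hk2 hk3 => by
          have h4 := mem_S_iff.1 hT.2 k
          have h5 := hbet k hk1 hk2
          rw [hk3] at h4
          tauto) hev
        have := compatible_iff.1 hD' i hlt.ne'
        tauto
    · have h1 := mem_S_iff.1 hDD' i
      have h2 := mem_S_iff.1 hT.2 i
      rw [← h1.resolve_right fun h => hi h.1, ← h2.resolve_right fun h => hi h.1]
  refine mem_S_iff.2 fun i => ?_
  rcases lt_trichotomy i (D'.arc i) with h | h | h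
  · exact Or.inl (key i h)
  · by_cases hi : T.arc i = i
    · exact Or.inl (h.symm.trans hi.symm)
    · refine Or.inr ⟨h.symm, ?_⟩
      have h1 := mem_S_iff.1 hDD' i
      have : D.arc i = i := by
        rw [← h] at h1; tauto
      exact (even_of_mem_S hT.2 this hi).1
  · left
    have h1 := key (D'.arc i) (by rwa [arc_arc])
    rw [arc_arc] at h1
    have h2 := congrArg T.arc h1
    rw [arc_arc] at h2
    exact h2.symm

/-- Every diagram can be completed to one without through points. -/
theorem exists_full (D : SymDiagram n) : ∃ M : SymDiagram n, D ∈ M.S ∧ ∀ i, M.arc i ≠ i := by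
  obtain ⟨M, hM, hmax⟩ := exists_max_image (univ.filter fun T : SymDiagram n => D ∈ T.S) size
    ⟨D, by simpa using D.mem_S_self⟩
  simp only [mem_filter, mem_univ, true_and] at hM hmax
  refine ⟨M, hM, fun i₀ hi₀ => ?_⟩
  obtain ⟨i, hi, hmin⟩ := exists_min_image (univ.filter fun i => M.arc i = i) id
    ⟨i₀, by simpa using hi₀⟩
  simp only [mem_filter, mem_univ, true_and, id] at hi hmin
  -- The points before the first through point are matched among themselves. Were it the only one,
  -- so would be the points after it, contradicting the even total `2 * n`; so a second exists and
  -- the two can be joined.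
  have hev : Even ((i : ℕ) - 0) := M.even_of_interval i.2.le fun k _ hk =>
    ⟨fun h => absurd (hmin k h) (not_le.2 hk), Nat.zero_le _, M.arc_lt_of_fixed hk hi⟩
  rw [Nat.sub_zero] at hev
  by_cases hlast : ∀ j, i < j → M.arc j ≠ j
  · have := M.even_of_interval (a := i + 1) le_rfl fun k hk _ =>
      ⟨hlast k hk, M.lt_arc_of_fixed (i := i) hk hi, (M.arc k).2⟩
    have := i.2
    rw [Nat.even_iff] at *
    omega
  · push Not at hlast
    obtain ⟨j, hj, hjmin⟩ := exists_min_image (univ.filter fun j => i < j ∧ M.arc j = j) id (by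
      obtain ⟨j, hj⟩ := hlast
      exact ⟨j, by simpa using hj⟩)
    simp only [mem_filter, mem_univ, true_and, id] at hj hjmin
    obtain ⟨M', h1, h2, -⟩ := M.exists_larger hj.1 hi hj.2 (fun k hk1 hk2 hk3 =>
      absurd (hjmin k ⟨hk1, hk3⟩) hk2.not_ge) hev
    exact absurd (hmax M' (mem_S_trans hM h1)) h2.not_ge

/-- A full completion pairs the through points of `D` with others of equal colour, so evenly many of
them lie in `I`. Each arc of `D` has exactly one end in `I`, so the rest of `I` has as many elements
as `D` has arcs. -/
theorem isEven_of_greatest {I : Finset (Fin (2 * n))} (hI : Even #I) (hD : D.Compatible I)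
    (hjoin : ∀ i j, i < j → D.arc i = i → D.arc j = j → (∀ k, i < k → k < j → D.arc k ≠ k) →
      Even (i : ℕ) → (i ∈ I ↔ j ∈ I)) : D.IsEven := by
  obtain ⟨M, hM, hfull⟩ := D.exists_full
  have hcol : ∀ i, D.arc i = i → (M.arc i ∈ I ↔ i ∈ I) := by
    have key : ∀ i, D.arc i = i → i < M.arc i → (i ∈ I ↔ M.arc i ∈ I) := by
      intro i hi hlt
      obtain ⟨hev, hj⟩ := even_of_mem_S hM hi hlt.ne'
      rw [min_eq_left hlt.le] at hev
      exact hjoin i _ hlt hi hj (not_fixed_between hM hi hlt) hev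
    intro i hi
    rcases lt_or_gt_of_ne (hfull i) with h | h
    · have := key (M.arc i) (even_of_mem_S hM hi (hfull i)).2 (by rwa [arc_arc])
      rwa [arc_arc] at this
    · exact (key i hi h).symm
  have h1 : Even #{i ∈ I | D.arc i = i} := by
    refine even_card_of_involution _ M.arc (fun i hi => ?_) (fun i _ => M.arc_arc i)
      fun i _ => hfull i
    rw [mem_filter] at hi ⊢
    exact ⟨(hcol i hi.2).2 hi.1, (even_of_mem_S hM hi.2 (hfull i)).2⟩
  have h2 : #{i ∈ I | ¬ D.arc i = i} = #{i : Fin (2 * n) | i < D.arc i} := by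
    have hc := compatible_iff.1 hD
    have e1 : #{i ∈ I | ¬ D.arc i = i} = #{i ∈ (Iᶜ : Finset _) | ¬ D.arc i = i} := by
      refine card_nbij' D.arc D.arc ?_ ?_ (fun i _ => D.arc_arc i) (fun i _ => D.arc_arc i)
      all_goals
        intro i
        have := hc i
        simp only [coe_filter, Set.mem_ofPred_eq, mem_compl, arc_arc]
        rintro ⟨h1, h2⟩
        exact ⟨by tauto, fun h => h2 h.symm⟩
    have e2 : #{i : Fin (2 * n) | i < D.arc i} = #{i : Fin (2 * n) | D.arc i < i} := by
      refine card_nbij' D.arc D.arc ?_ ?_ (fun i _ => D.arc_arc i) (fun i _ => D.arc_arc i)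
      all_goals
        intro i
        simp only [coe_filter, Set.mem_ofPred_eq, mem_univ, true_and, arc_arc]
        exact id
    have e3 : #{i ∈ I | ¬ D.arc i = i} + #{i ∈ (Iᶜ : Finset _) | ¬ D.arc i = i} =
        #{i : Fin (2 * n) | ¬ D.arc i = i} := by
      rw [← card_union_of_disjoint (disjoint_filter_filter disjoint_compl_right),
        ← filter_union, union_compl]
    have e4 : #{i : Fin (2 * n) | i < D.arc i} + #{i : Fin (2 * n) | D.arc i < i} =
        #{i : Fin (2 * n) | ¬ D.arc i = i} := by
      rw [← card_union_of_disjoint (disjoint_filter.2 fun i _ h => h.not_gt), ← filter_or]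
      congr 1
      ext i
      simp only [mem_filter, mem_univ, true_and]
      omega
    omega
  rw [IsEven, order_eq, ← h2]
  rw [← card_filter_add_card_filter_not (fun i => D.arc i = i), Nat.even_add] at hI
  exact hI.1 h1

/-- Maximality does not depend on the witness: `D` is the greatest compatible completion of its
witness, and the greatest one of any `D'` in `S(D)` also completes that witness, hence lies in
`S(D)`. This makes the sets `S(D)` of distinct maximal diagrams disjoint. -/
theorem IsMaximal.mem_S_of_mem_S {I : Finset (Fin (2 * n))} (hD : D.IsMaximal I) (h : D' ∈ D.S)
    (hD'' : D''.Compatible I) (h' : D' ∈ D''.S) : D'' ∈ D.S := by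
  obtain ⟨-, hc, D₀, h0, h0S, hmax⟩ := hD
  obtain ⟨T, hT, hT0, hTmax, -⟩ := exists_greatest h0
  have hDT : D = T := mem_S_antisymm (hTmax D hc h0S) (hmax T hT hT0 T.mem_S_self)
  obtain ⟨T', hT', hT0', hTmax', -⟩ := exists_greatest (hc.of_mem_S h)
  have h1 := hTmax' D hc h
  have h2 := hTmax T' hT' (mem_S_trans h0S h1)
  rw [← hDT] at h2
  exact mem_S_trans (hTmax' D'' hD'' h') h2

/-- The sets `S(D)` of the `I`-maximal diagrams partition the set of the `I`-compatible ones. -/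
theorem sum_maximalDiagrams {I : Finset (Fin (2 * n))} (hI : Even #I) {M : Type*}
    [AddCommMonoid M] (f : SymDiagram n → M) :
    ∑ D ∈ maximalDiagrams I, ∑ D' ∈ D.S, f D' = ∑ D : SymDiagram n with D.Compatible I, f D := by
  rw [← sum_biUnion]
  · congr 1
    ext D
    simp only [mem_biUnion, maximalDiagrams, mem_filter, mem_univ, true_and]
    constructor
    · rintro ⟨D', hD', h⟩
      exact hD'.2.1.of_mem_S h
    · intro hD
      obtain ⟨T, hT, hDT, hmax, hjoin⟩ := exists_greatest hD
      exact ⟨T, ⟨isEven_of_greatest hI hT hjoin, hT, D, hD, hDT, fun D'' h h' E hE =>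
        mem_S_trans hE (hmax D'' h h')⟩, hDT⟩
  · intro D₁ h₁ D₂ h₂ hne
    simp only [maximalDiagrams, coe_filter, mem_univ, true_and, Set.mem_ofPred_eq] at h₁ h₂
    refine disjoint_left.2 fun D h h' => hne ?_
    exact mem_S_antisymm (h₂.mem_S_of_mem_S h' h₁.2.1 h) (h₁.mem_S_of_mem_S h h₂.2.1 h')

end SymDiagram

/-- The product of complementary pfaffians is the sum of the TL-pfaffinants of the maximal
diagrams. -/
theorem subPfaffian_mul_eq_sum_tlPfaffinant {n : ℕ} {R : Type*} [CommRing R]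
    (A : Matrix (Fin (2 * n)) (Fin (2 * n)) R)
    (emb : ∀ π : Matching (Fin (2 * n)), NiceEmbedding π)
    (I : Finset (Fin (2 * n))) (hI : Even #I) :
    subPfaffian I A * subPfaffian Iᶜ A = ∑ D ∈ maximalDiagrams I, tlPfaffinant emb D A := by
  simp only [tlPfaffinant]
  rw [SymDiagram.sum_maximalDiagrams hI]
  simp only [diagramPfaffinant]
  rw [sum_comm, subPfaffian_mul_subPfaffian_compl, sum_filter]
  refine sum_congr rfl fun π _ => ?_
  rw [← sum_mul, ← Int.cast_sum]
  split_ifs with h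
  · rw [NiceEmbedding.sum_coeff_eq_sign h, NiceEmbedding.sign_strandUncrossing h]
    push_cast
    rfl
  · rw [NiceEmbedding.sum_coeff_eq_zero h, Int.cast_zero, zero_mul]

end

end TLPfaffinant

theorem mainTheorem1 {R : Type*} [CommRing R] (n : ℕ)
    (A : Matrix (Fin (2 * n)) (Fin (2 * n)) R) (hA : Aᵀ = -A)
    (emb : ∀ π : TLPfaffinant.Matching (Fin (2 * n)), TLPfaffinant.NiceEmbedding π)
    (I : Finset (Fin (2 * n))) (hI : Even I.card) :
    TLPfaffinant.subPfaffian I A * TLPfaffinant.subPfaffian Iᶜ A =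
      ∑ D ∈ TLPfaffinant.maximalDiagrams I, TLPfaffinant.tlPfaffinant emb D A := by
  exact TLPfaffinant.subPfaffian_mul_eq_sum_tlPfaffinant A emb I hI
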